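/- Let $n,N\ge 1$ be integers, $T>0$, $A\in\mathbb R^{n\times n}$ and $B\in\mathbb R^{n\times 1}$. Let $0\le U_{\min}=U_1<U_2<\dots<U_N=1$, and let $w_1,\dots,w_N>0$ be weights with $w_1+\dots+w_N=1$. For $\xi\in\mathbb R^n$ let $\mathcal U(\xi)$ be the set of measurable $u:[0,T]\to\mathbb R$ with $\|u\|_\infty\le 1$ for which the solution of $\dot x=Ax+Bu$, $x(0)=\xi$, satisfies $x(T)=0$. Put $$J(u)=\sum_{i=1}^N w_i\bigl(\|u-U_i\|_1+\|u+U_i\|_1\bigr),$$ where $\|v\|_1=\int_0^T|v(t)|\,dt$. An SOAV (sum-of-absolute-values) optimal control for $\xi$ is a minimizer of $J$ over $\mathcal U(\xi)$. Let $$\mathcal R=\Bigl\{\int_0^T e^{-At}Bu(t)\,dt:\ u \text{ measurable},\ \|u\|_\infty\le 1\Bigr\},$$ and let $\mathcal R_{\min}$ be the set of all $\xi$ for which $\min_{u\in\mathcal U(\xi)}J(u)$ is attained and equals $J_{\min}=2T\sum_{i=1}^N w_iU_i$. The switching instants of a control $u$ are the $t\in(0,T)$ such that $u$ is not almost everywhere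 constant on any neighbourhood of $t$ (for a piecewise constant control, the times at which its value changes). **Theorem (number of switchings).** Assume that $A$ is nonsingular and that $(A,B)$ is controllable, and let $\Omega$ be the largest imaginary part of the complex eigenvalues of $A$. If $\xi\in\mathcal R\setminus\mathcal R_{\min}$, then every SOAV optimal control for $\xi$ has only finitely many switching instants, and their number $M$ satisfies $$M<n(2N-1)\left(1+\frac{\Omega T}{\pi}\right).$$ If $U_{\min}=0$, then for every $\xi\in\mathcal R$, every SOAV optimal control for $\xi$ has only finitely many switching instants, and their number $M$ satisfies $$M<2n(N-1)\left(1+\frac{\Omega T}{\pi}\right).$$ -/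

import Mathlib

namespace SOAV

open MeasureTheory

/-- The controllability matrix `[B, A B, …, A^{n-1} B]` of a single-input pair `(A, B)`. -/
def controllabilityMatrix {n : ℕ} (A : Matrix (Fin n) (Fin n) ℝ) (B : Fin n → ℝ) :
    Matrix (Fin n) (Fin n) ℝ :=
  Matrix.of fun i j => ((A ^ (j : ℕ)).mulVec B) i

/-- Controllability of `(A, B)` (Kalman rank condition). -/
def IsControllable {n : ℕ} (A : Matrix (Fin n) (Fin n) ℝ) (B : Fin n → ℝ) : Prop :=
  (controllabilityMatrix A B).rank = n

/-- `u` is a measurable control on `[0, T]` with `‖u‖_∞ ≤ 1`. Only the restriction of `u` to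
`[0, T]`, up to null sets, matters here and below. -/
def IsControl (T : ℝ) (u : ℝ → ℝ) : Prop :=
  AEStronglyMeasurable u (volume.restrict (Set.Icc 0 T)) ∧
    ∀ᵐ t ∂(volume.restrict (Set.Icc 0 T)), |u t| ≤ 1

/-- `x` is the (Carathéodory) trajectory on `[0, T]` of `x' = A x + B u`, `x 0 = ξ`. -/
def IsTrajectory {n : ℕ} (A : Matrix (Fin n) (Fin n) ℝ) (B : Fin n → ℝ) (T : ℝ)
    (ξ : Fin n → ℝ) (u : ℝ → ℝ) (x : ℝ → Fin n → ℝ) : Prop :=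
  ContinuousOn x (Set.Icc 0 T) ∧
    ∀ t ∈ Set.Icc 0 T, x t = ξ + ∫ s in (0 : ℝ)..t, (A.mulVec (x s) + u s • B)

/-- The set `𝒰(ξ)` of feasible controls: `‖u‖_∞ ≤ 1`, `x 0 = ξ` and `x T = 0`. -/
def feasible {n : ℕ} (A : Matrix (Fin n) (Fin n) ℝ) (B : Fin n → ℝ) (T : ℝ)
    (ξ : Fin n → ℝ) : Set (ℝ → ℝ) :=
  {u | IsControl T u ∧ ∃ x : ℝ → Fin n → ℝ, IsTrajectory A B T ξ u x ∧ x T = 0}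

/-- The cost `J(u) = ∑ i, w i (‖u - U i‖₁ + ‖u + U i‖₁)`, with `L¹` norms on `[0, T]`. -/
noncomputable def cost {N : ℕ} (U w : Fin N → ℝ) (T : ℝ) (u : ℝ → ℝ) : ℝ :=
  ∑ i, w i * ((∫ t in (0 : ℝ)..T, |u t - U i|) + ∫ t in (0 : ℝ)..T, |u t + U i|)

/-- `u` is an SOAV optimal control for the initial state `ξ`. -/
def IsOptimal {n N : ℕ} (A : Matrix (Fin n) (Fin n) ℝ) (B : Fin n → ℝ) (U w : Fin N → ℝ)
    (T : ℝ) (ξ : Fin n → ℝ) (u : ℝ → ℝ) : Prop :=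
  u ∈ feasible A B T ξ ∧ ∀ v ∈ feasible A B T ξ, cost U w T u ≤ cost U w T v

/-- The reachable set `ℛ = {∫₀ᵀ e^{-At} B u(t) dt : ‖u‖_∞ ≤ 1}`. -/
def reachable {n : ℕ} (A : Matrix (Fin n) (Fin n) ℝ) (B : Fin n → ℝ) (T : ℝ) :
    Set (Fin n → ℝ) :=
  {ξ | ∃ u : ℝ → ℝ, IsControl T u ∧
    ξ = ∫ t in (0 : ℝ)..T, u t • (NormedSpace.exp (-(t • A))).mulVec B}

/-- `J_min = 2 T ∑ i, w i * U i`. -/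
def costMin {N : ℕ} (U w : Fin N → ℝ) (T : ℝ) : ℝ :=
  2 * T * ∑ i, w i * U i

/-- `ℛ_min`: the initial states whose optimal value `min {J(u) : u ∈ 𝒰(ξ)}` equals `J_min`. -/
def reachableMin {n N : ℕ} (A : Matrix (Fin n) (Fin n) ℝ) (B : Fin n → ℝ) (U w : Fin N → ℝ)
    (T : ℝ) : Set (Fin n → ℝ) :=
  {ξ | IsLeast (cost U w T '' feasible A B T ξ) (costMin U w T)}

/-- The switching instants of `u` in `(0, T)`: the times around which `u` is not a.e. constant.
For a function that agrees a.e. with a piecewise constant function these are exactly the times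
at which the constant value changes; conversely, if there are finitely many of them, `u` agrees
a.e. on `[0, T]` with a piecewise constant function that jumps exactly there. -/
def switchingInstants (T : ℝ) (u : ℝ → ℝ) : Set ℝ :=
  {t | t ∈ Set.Ioo 0 T ∧
    ¬ ∃ ε > 0, ∃ c : ℝ, ∀ᵐ s ∂(volume.restrict (Set.Ioo (t - ε) (t + ε))), u s = c}

/-- The set of imaginary parts of the (complex) eigenvalues of the real matrix `A`. -/
def eigenvalueImParts {n : ℕ} (A : Matrix (Fin n) (Fin n) ℝ) : Set ℝ :=
  {y | ∃ z : ℂ, Module.End.HasEigenvalue (Matrix.toLin' (A.map (fun a => (a : ℂ)))) z ∧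
    z.im = y}

end SOAV

/-! Write p(t) = λᵀ e^{-tA} B. Separating the optimal point from the convex set of pairs (number
above the cost, steering integral) gives multipliers c ≥ 0 and λ, not both zero; for each fixed d in
[-1, 1], u(t) does at least as well as d in v ↦ c L(v) + v p(t) for almost every t, where L is the
running cost (`IsOptimal.exists_multiplier`, `ae_le_of_integral_le`). L is even, convex and
piecewise linear, with slopes ± s_k, s_k = 2(w_1 + … + w_k), and also 0 if U_min > 0. So for c > 0
the minimizer is unique and locally constant unless p/c equals some ± s_k with 1 ≤ k ≤ N - 1, or
vanishes while U_min > 0. For c = 0 only the zeros of p matter.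

It remains to count level crossings. By Cayley–Hamilton p solves a linear differential equation with
constant coefficients, and by controllability p ≠ 0 when λ ≠ 0. Rolle's theorem, applied once per
factor of the characteristic polynomial, leaves p at most n - 1 zeros on an interval shorter than
π/Ω (`eq_zero_of_natDegree_le_card_zeros`). As A is nonsingular, p' is a nonzero function of the
same kind, so p² takes a given value at most 2(n - 1) + 1 times. Such an interval contains at most
(N - 1)(2n - 1) switchings, plus n - 1 more if U_min > 0, and ⌊ΩT/π⌋ + 1 of them cover [0, T].

If λ = 0, then u minimizes L almost everywhere: ξ lies in ℛ_min, and for U_min = 0 there is no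
switching. -/

namespace SOAV

open MeasureTheory

/-! ### Rolle's theorem and disconjugacy -/

/-- Rolle's theorem, counting points: a function taking the same value at `m + 1` points of an
interval has a derivative vanishing at `m` points of it. -/
theorem exists_finset_deriv_eq_zero {f f' : ℝ → ℝ} {I : Set ℝ} (hI : I.OrdConnected)
    (hf : ∀ t ∈ I, HasDerivAt f (f' t) t) (c : ℝ) (s : Finset ℝ) (hs : ∀ x ∈ s, x ∈ I)
    (hc : ∀ x ∈ s, f x = c) :
    ∃ s' : Finset ℝ, (∀ x ∈ s', x ∈ I) ∧ (∀ x ∈ s', f' x = 0) ∧ s.card ≤ s'.card + 1 := by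
  rcases Nat.eq_zero_or_pos s.card with h0 | h0
  · exact ⟨∅, by simp, by simp, by omega⟩
  obtain ⟨m, hm⟩ : ∃ m, s.card = m + 1 := ⟨s.card - 1, by omega⟩
  let z := s.orderEmbOfFin hm
  have hz : ∀ i, z i ∈ s := fun i => s.orderEmbOfFin_mem hm i
  have key : ∀ i : Fin m, ∃ y ∈ Set.Ioo (z i.castSucc) (z i.succ), f' y = 0 := by
    intro i
    have hlt : z i.castSucc < z i.succ := z.strictMono i.castSucc_lt_succ
    have hsub : Set.Icc (z i.castSucc) (z i.succ) ⊆ I := hI.out (hs _ (hz _)) (hs _ (hz _))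
    exact exists_hasDerivAt_eq_zero hlt
      (fun x hx => (hf x (hsub hx)).continuousAt.continuousWithinAt)
      (by rw [hc _ (hz _), hc _ (hz _)]) (fun x hx => hf x (hsub (Set.Ioo_subset_Icc_self hx)))
  choose y hy hy0 using key
  have hmono : StrictMono y := by
    intro i j hij
    calc y i < z i.succ := (hy i).2
      _ ≤ z j.castSucc := z.monotone (by
        rw [Fin.le_def]; simp only [Fin.val_succ, Fin.val_castSucc]; exact hij)
      _ < y j := (hy j).1
  refine ⟨Finset.univ.image y, ?_, ?_, ?_⟩
  · simp only [Finset.mem_image, Finset.mem_univ, true_and]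
    rintro _ ⟨i, rfl⟩
    exact hI.out (hs _ (hz _)) (hs _ (hz _)) (Set.Ioo_subset_Icc_self (hy i))
  · simp only [Finset.mem_image, Finset.mem_univ, true_and]
    rintro _ ⟨i, rfl⟩
    exact hy0 i
  · rw [Finset.card_image_of_injective _ hmono.injective, Finset.card_univ, Fintype.card_fin, hm]

/-- The derivative of `e^{-a t} f`. -/
theorem hasDerivAt_exp_neg_mul {f : ℝ → ℝ} {f' t : ℝ} (a : ℝ) (hf : HasDerivAt f f' t) :
    HasDerivAt (fun t => Real.exp (-(a * t)) * f t) (Real.exp (-(a * t)) * (f' - a * f t)) t := by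
  have h1 : HasDerivAt (fun t : ℝ => -(a * t)) (-(a * 1)) t := ((hasDerivAt_id t).const_mul a).neg
  have h2 := h1.exp.mul hf
  exact h2.congr_deriv (by ring)

/-- Zeros of `f` force zeros of `f' - a f`. -/
theorem exists_finset_first_order {f f' : ℝ → ℝ} (hf : ∀ t, HasDerivAt f (f' t) t) (a : ℝ)
    {I : Set ℝ} (hI : I.OrdConnected) (s : Finset ℝ) (hs : ∀ x ∈ s, x ∈ I)
    (hc : ∀ x ∈ s, f x = 0) :
    ∃ s' : Finset ℝ, (∀ x ∈ s', x ∈ I) ∧ (∀ x ∈ s', f' x - a * f x = 0) ∧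
      s.card ≤ s'.card + 1 := by
  obtain ⟨s', h1, h2, h3⟩ := exists_finset_deriv_eq_zero hI
    (fun t _ => hasDerivAt_exp_neg_mul a (hf t)) 0 s hs (fun x hx => by simp [hc x hx])
  exact ⟨s', h1, fun x hx => (mul_eq_zero.1 (h2 x hx)).resolve_left (Real.exp_ne_zero _), h3⟩

/-- Zeros of `h` on an interval shorter than `π / β` force zeros of `h'' + β² h`. -/
theorem exists_finset_second_order {h h' h'' : ℝ → ℝ} (hh : ∀ t, HasDerivAt h (h' t) t)
    (hh' : ∀ t, HasDerivAt h' (h'' t) t) {a b β : ℝ} (hβ : 0 < β) (hab : β * (b - a) < Real.pi)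
    (s : Finset ℝ) (hs : ∀ x ∈ s, x ∈ Set.Icc a b) (hc : ∀ x ∈ s, h x = 0) :
    ∃ s' : Finset ℝ, (∀ x ∈ s', x ∈ Set.Icc a b) ∧ (∀ x ∈ s', h'' x + β ^ 2 * h x = 0) ∧
      s.card ≤ s'.card + 2 := by
  -- The cosine centred at the midpoint is positive on [a, b] and solves w'' + β²w = 0. Rolle is
  -- applied to h/w, then to the Wronskian h'w - hw', whose derivative is w(h'' + β²h).
  set m := (a + b) / 2 with hm
  have hθ : ∀ t : ℝ, HasDerivAt (fun t : ℝ => β * (t - m)) (β * 1) t :=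
    fun t => ((hasDerivAt_id t).sub_const m).const_mul β
  have hw : ∀ t : ℝ, HasDerivAt (fun t : ℝ => Real.cos (β * (t - m)))
      (-Real.sin (β * (t - m)) * (β * 1)) t := fun t => (hθ t).cos
  have hv : ∀ t : ℝ, HasDerivAt (fun t : ℝ => -Real.sin (β * (t - m)) * (β * 1))
      (-(Real.cos (β * (t - m)) * (β * 1)) * (β * 1)) t :=
    fun t => ((hθ t).sin.neg).mul_const _
  have hpos : ∀ t ∈ Set.Icc a b, 0 < Real.cos (β * (t - m)) := by
    intro t ht
    have h1 : t - m ≤ (b - a) / 2 := by rw [hm]; linarith [ht.2]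
    have h2 : -((b - a) / 2) ≤ t - m := by rw [hm]; linarith [ht.1]
    apply Real.cos_pos_of_mem_Ioo
    constructor
    · have := mul_le_mul_of_nonneg_left h2 hβ.le
      linarith
    · have := mul_le_mul_of_nonneg_left h1 hβ.le
      linarith
  obtain ⟨s₁, h11, h12, h13⟩ := exists_finset_deriv_eq_zero (Set.ordConnected_Icc (a := a) (b := b))
    (fun t ht => (hh t).div (hw t) (hpos t ht).ne') 0 s hs (fun x hx => by simp [hc x hx])
  obtain ⟨s₂, h21, h22, h23⟩ := exists_finset_deriv_eq_zero (Set.ordConnected_Icc (a := a) (b := b))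
    (fun t _ => ((hh' t).mul (hw t)).sub ((hh t).mul (hv t))) 0 s₁ h11 (fun x hx => by
      have := h12 x hx
      rw [div_eq_zero_iff] at this
      rcases this with h | h
      · simpa using h
      · exact absurd (pow_eq_zero_iff two_ne_zero |>.1 h) (hpos x (h11 x hx)).ne')
  refine ⟨s₂, h21, fun x hx => ?_, by omega⟩
  have hk := h22 x hx
  have : Real.cos (β * (x - m)) * (h'' x + β ^ 2 * h x) = 0 := by

    linear_combination hk
  exact (mul_eq_zero.1 this).resolve_left (hpos x (h21 x hx)).ne'

/-- A solution of `h'' + β² h = 0` with two zeros at distance less than `π / β` vanishes. -/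
theorem eq_zero_of_second_order {h h' : ℝ → ℝ} {β : ℝ} (hβ : 0 < β)
    (hh : ∀ t, HasDerivAt h (h' t) t) (hh' : ∀ t, HasDerivAt h' (-(β ^ 2 * h t)) t)
    {t₀ t₁ : ℝ} (h01 : t₀ < t₁) (hlt : β * (t₁ - t₀) < Real.pi) (h0 : h t₀ = 0) (h1 : h t₁ = 0)
    (t : ℝ) : h t = 0 := by
  have hθ : ∀ t : ℝ, HasDerivAt (fun t : ℝ => β * (t - t₀)) (β * 1) t :=
    fun t => ((hasDerivAt_id t).sub_const t₀).const_mul β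
  have hcos : ∀ t : ℝ, HasDerivAt (fun t : ℝ => Real.cos (β * (t - t₀)))
      (-Real.sin (β * (t - t₀)) * (β * 1)) t := fun t => (hθ t).cos
  have hsin : ∀ t : ℝ, HasDerivAt (fun t : ℝ => Real.sin (β * (t - t₀)))
      (Real.cos (β * (t - t₀)) * (β * 1)) t := fun t => (hθ t).sin
  -- Two first integrals: (βh, h') is constant in a rotating frame, whence βh = h'(t₀) sin(β(t -
  -- t₀)).
  have hk1 : ∀ t, HasDerivAt (fun t => β * (h t * Real.cos (β * (t - t₀)))
      - h' t * Real.sin (β * (t - t₀))) 0 t := by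
    intro t
    exact ((((hh t).mul (hcos t)).const_mul β).sub ((hh' t).mul (hsin t))).congr_deriv (by ring)
  have hk2 : ∀ t, HasDerivAt (fun t => β * (h t * Real.sin (β * (t - t₀)))
      + h' t * Real.cos (β * (t - t₀))) 0 t := by
    intro t
    exact ((((hh t).mul (hsin t)).const_mul β).add ((hh' t).mul (hcos t))).congr_deriv (by ring)
  have c1 := fun t => is_const_of_deriv_eq_zero (fun t => (hk1 t).differentiableAt)
    (fun t => (hk1 t).deriv) t t₀
  have c2 := fun t => is_const_of_deriv_eq_zero (fun t => (hk2 t).differentiableAt)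
    (fun t => (hk2 t).deriv) t t₀
  simp only [h0, sub_self, mul_zero, Real.cos_zero, Real.sin_zero, mul_one,
    zero_add] at c1 c2
  have key : ∀ t, β * h t = h' t₀ * Real.sin (β * (t - t₀)) := by
    intro t
    have := Real.sin_sq_add_cos_sq (β * (t - t₀))
    linear_combination Real.cos (β * (t - t₀)) * c1 t + Real.sin (β * (t - t₀)) * c2 t
      - β * h t * this
  have hpos : 0 < Real.sin (β * (t₁ - t₀)) :=
    Real.sin_pos_of_pos_of_lt_pi (mul_pos hβ (sub_pos.2 h01)) hlt
  have hd : h' t₀ = 0 := by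
    have := key t₁
    rw [h1, mul_zero] at this
    exact (mul_eq_zero.1 this.symm).resolve_right hpos.ne'
  have := key t
  rw [hd, zero_mul] at this
  exact (mul_eq_zero.1 this).resolve_left hβ.ne'

open Polynomial in
/-- Disconjugacy: a solution of a linear differential equation `Q(d/dt) f = 0` with constant
coefficients that has `deg Q` zeros on an interval of length less than `π / Ω` vanishes, where
`Ω` bounds the imaginary parts of the roots of `Q`. -/
theorem eq_zero_of_natDegree_le_card_zeros {V : Type*} [AddCommGroup V] [Module ℝ V]
    (D : Module.End ℝ V) (ρ : V →ₗ[ℝ] (ℝ → ℝ)) (hρ : ∀ v t, HasDerivAt (ρ v) (ρ (D v) t) t)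
    {Ω a b : ℝ} (hab : a ≤ b) (hΩ : Ω * (b - a) < Real.pi) (d : ℕ) :
    ∀ Q : ℝ[X], Q.natDegree = d → Q ≠ 0 → (∀ z : ℂ, aeval z Q = 0 → |z.im| ≤ Ω) →
      ∀ v, aeval D Q v = 0 → ∀ s : Finset ℝ, (∀ x ∈ s, x ∈ Set.Icc a b) →
        (∀ x ∈ s, ρ v x = 0) → d ≤ s.card → ∀ t, ρ v t = 0 := by
  induction d using Nat.strong_induction_on with
  | _ d ih =>
  intro Q hd hQ hroot v hv s hs hz hcard t
  rcases Nat.eq_zero_or_pos d with h0 | hpos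
  · rw [h0] at hd
    rw [natDegree_eq_zero] at hd
    obtain ⟨c, rfl⟩ := hd
    have hc : c ≠ 0 := by rintro rfl; simp at hQ
    have : v = 0 := by simpa [hc, Algebra.algebraMap_eq_smul_one] using hv
    simp [this]
  obtain ⟨z, hz0⟩ : ∃ z : ℂ, aeval z Q = 0 := by
    have hdeg : (Q.map (algebraMap ℝ ℂ)).degree ≠ 0 := by
      rw [degree_map]
      intro h
      have := natDegree_eq_of_degree_eq_some (n := 0) h
      omega
    obtain ⟨z, hz⟩ := IsAlgClosed.exists_root (Q.map (algebraMap ℝ ℂ)) hdeg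
    exact ⟨z, by simpa [aeval_def, eval_map] using hz⟩
  by_cases him : z.im = 0
  · have hr : Q.IsRoot z.re := by
      have hzz : z = ((z.re : ℝ) : ℂ) := by apply Complex.ext <;> simp [him]
      rw [hzz] at hz0
      have : ((Q.eval z.re : ℝ) : ℂ) = 0 := by
        rw [← hz0]
        exact (aeval_algebraMap_apply_eq_algebraMap_eval z.re Q).symm
      exact_mod_cast this
    obtain ⟨Q', rfl⟩ := dvd_iff_isRoot.2 hr
    have hQ' : Q' ≠ 0 := right_ne_zero_of_mul hQ
    have hd' : Q'.natDegree + 1 = d := by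
      rw [← hd, natDegree_mul (X_sub_C_ne_zero _) hQ', natDegree_X_sub_C, add_comm]
    obtain ⟨s', hs', hz', hcard'⟩ := exists_finset_first_order (hρ v) z.re
      (Set.ordConnected_Icc (a := a) (b := b)) s hs hz
    set v' : V := D v - z.re • v with hv'
    have hval : ∀ t, ρ v' t = ρ (D v) t - z.re * ρ v t := by
      intro t; simp [hv', map_sub, map_smul]
    have hg := ih Q'.natDegree (by omega) Q' rfl hQ'
      (fun y hy => hroot y (by rw [map_mul, hy, mul_zero])) v' (by
        rw [mul_comm, map_mul] at hv
        simpa [hv', Algebra.algebraMap_eq_smul_one] using hv) s' hs'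
        (fun x hx => by rw [hval]; exact hz' x hx) (by omega)
    -- Now f' = rf for the real root r, and `d > 0` provides a zero of f, which fixes the constant.
    have hconst : ∀ t, HasDerivAt (fun t => Real.exp (-(z.re * t)) * ρ v t) 0 t := by
      intro t
      have := hasDerivAt_exp_neg_mul z.re (hρ v t)
      rwa [← hval, hg, mul_zero] at this
    obtain ⟨x, hx⟩ : s.Nonempty := Finset.card_pos.1 (by omega)
    have := is_const_of_deriv_eq_zero (fun t => (hconst t).differentiableAt)
      (fun t => (hconst t).deriv) t x
    simp only [hz x hx, mul_zero] at this
    exact (mul_eq_zero.1 this).resolve_left (Real.exp_ne_zero _)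
  · set α := z.re
    set β := |z.im| with hβdef
    have hβ : 0 < β := abs_pos.2 him
    have hβΩ : β * (b - a) < Real.pi :=
      (mul_le_mul_of_nonneg_right (hroot z hz0) (sub_nonneg.2 hab)).trans_lt hΩ
    have hnorm : ‖z‖ ^ 2 = α ^ 2 + β ^ 2 := by
      rw [hβdef, sq_abs, Complex.sq_norm, Complex.normSq_apply]
      ring
    have hdvd := quadratic_dvd_of_aeval_eq_zero_im_ne_zero Q hz0 him
    have hqdeg : (X ^ 2 - C (2 * z.re) * X + C (‖z‖ ^ 2) : ℝ[X]).natDegree = 2 := by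
      compute_degree!
    obtain ⟨Q', rfl⟩ := hdvd
    have hQ' : Q' ≠ 0 := right_ne_zero_of_mul hQ
    have hd' : Q'.natDegree + 2 = d := by
      rw [← hd, natDegree_mul (left_ne_zero_of_mul hQ) hQ', hqdeg, add_comm]
    have hh1 : ∀ t, HasDerivAt (fun t => Real.exp (-(α * t)) * ρ v t)
        (Real.exp (-(α * t)) * (ρ (D v) t - α * ρ v t)) t :=
      fun t => hasDerivAt_exp_neg_mul α (hρ v t)
    have hh2 : ∀ t, HasDerivAt (fun t => Real.exp (-(α * t)) * (ρ (D v) t - α * ρ v t))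
        (Real.exp (-(α * t)) * ((ρ (D (D v)) t - α * ρ (D v) t)
          - α * (ρ (D v) t - α * ρ v t))) t :=
      fun t => hasDerivAt_exp_neg_mul α ((hρ (D v) t).sub ((hρ v t).const_mul α))
    set v' : V := D (D v) - (2 * α) • D v + (‖z‖ ^ 2) • v with hv'
    have hval : ∀ t, ρ v' t = ρ (D (D v)) t - 2 * α * ρ (D v) t + (α ^ 2 + β ^ 2) * ρ v t := by
      intro t
      rw [← hnorm]
      simp [hv', map_sub, map_add, map_smul]
    obtain ⟨s', hs', hz', hcard'⟩ := exists_finset_second_order hh1 hh2 hβ hβΩ s hs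
      (fun x hx => by rw [hz x hx, mul_zero])
    have hg := ih Q'.natDegree (by omega) Q' rfl hQ'
      (fun y hy => hroot y (by rw [map_mul, hy, mul_zero])) v' (by
        rw [mul_comm, map_mul] at hv
        -- Constant coefficients become scalar multiples, so that `aeval` unfolds by linearity.
        rw [← smul_eq_C_mul, ← mul_one (C (‖z‖ ^ 2)), ← smul_eq_C_mul] at hv
        simp only [map_add, map_sub, map_smul, map_pow, aeval_X, map_one, pow_two D,
          Module.End.mul_apply, LinearMap.add_apply, LinearMap.sub_apply, LinearMap.smul_apply, Module.End.one_apply] at hv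
        simpa only [hv', map_add, map_sub, map_smul] using hv) s' hs'
        (fun x hx => by
          rw [hval]
          have : Real.exp (-(α * x)) * (ρ (D (D v)) x - 2 * α * ρ (D v) x
              + (α ^ 2 + β ^ 2) * ρ v x) = 0 := by linear_combination hz' x hx
          exact (mul_eq_zero.1 this).resolve_left (Real.exp_ne_zero _)) (by omega)
    -- A nonreal root uses up two degrees, so at least two zeros are given, and they are closer than
    -- π/β.
    have hcard2 : 1 < s.card := by omega
    obtain ⟨x, hx, y, hy, hxy⟩ := Finset.one_lt_card.1 hcard2
    have hfin : ∀ x ∈ s, ∀ y ∈ s, x < y → ρ v t = 0 := by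
      intro x hx y hy hxy
      have hlt : β * (y - x) < Real.pi :=
        (mul_le_mul_of_nonneg_left (by linarith [(hs x hx).1, (hs y hy).2]) hβ.le).trans_lt hβΩ
      have := eq_zero_of_second_order hβ hh1 (fun t => (hh2 t).congr_deriv (by
        have := hval t
        rw [hg] at this
        linear_combination -Real.exp (-(α * t)) * this)) hxy hlt (by rw [hz x hx, mul_zero])
        (by rw [hz y hy, mul_zero]) t
      exact (mul_eq_zero.1 this).resolve_left (Real.exp_ne_zero _)
    rcases lt_or_gt_of_ne hxy with h | h
    · exact hfin x hx y hy h
    · exact hfin y hy x hx h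

/-! ### The response and its zeros -/

open Matrix

variable {n : ℕ}

/-- The response `t ↦ λᵀ e^{tM} B`, as a linear function of `λ`. -/
noncomputable def response (M : Matrix (Fin n) (Fin n) ℝ) (B : Fin n → ℝ) :
    (Fin n → ℝ) →ₗ[ℝ] (ℝ → ℝ) where
  toFun l t := l ⬝ᵥ (NormedSpace.exp (t • M)) *ᵥ B
  map_add' l l' := by ext t; simp [add_dotProduct]
  map_smul' c l := by ext t; simp [smul_dotProduct]

theorem response_apply (M : Matrix (Fin n) (Fin n) ℝ) (B l : Fin n → ℝ) (t : ℝ) :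
    response M B l t = l ⬝ᵥ (NormedSpace.exp (t • M)) *ᵥ B := rfl

section

attribute [local instance] Matrix.linftyOpNormedRing Matrix.linftyOpNormedAlgebra

/-- The derivative of the matrix exponential, in terms of bilinear expressions. -/
theorem hasDerivAt_dotProduct_exp_mulVec (M : Matrix (Fin n) (Fin n) ℝ) (l B : Fin n → ℝ) (t : ℝ) :
    HasDerivAt (fun t : ℝ => l ⬝ᵥ (NormedSpace.exp (t • M)) *ᵥ B)
      (l ⬝ᵥ (M * NormedSpace.exp (t • M)) *ᵥ B) t := by
  let φ : Matrix (Fin n) (Fin n) ℝ →ₗ[ℝ] ℝ :=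
    { toFun := fun X => l ⬝ᵥ X *ᵥ B
      map_add' := fun X Y => by rw [add_mulVec, dotProduct_add]
      map_smul' := fun c X => by rw [smul_mulVec, dotProduct_smul]; rfl }
  exact (LinearMap.toContinuousLinearMap φ).hasFDerivAt.comp_hasDerivAt t
    (hasDerivAt_exp_smul_const' M t)

end

/-- Differentiation in time acts on λ as Mᵀ. This is what lets the disconjugacy theorem apply with V
the space of vectors λ and D = Mᵀ. -/
theorem hasDerivAt_response (M : Matrix (Fin n) (Fin n) ℝ) (B l : Fin n → ℝ) (t : ℝ) :
    HasDerivAt (response M B l) (response M B (Mᵀ.mulVecLin l) t) t := by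
  have h := hasDerivAt_dotProduct_exp_mulVec M l B t
  rw [← mulVec_mulVec, dotProduct_mulVec] at h
  rw [response_apply, mulVecLin_apply, mulVec_transpose]
  exact h

theorem continuous_response (M : Matrix (Fin n) (Fin n) ℝ) (B l : Fin n → ℝ) :
    Continuous (response M B l) :=
  continuous_iff_continuousAt.2 fun t => (hasDerivAt_response M B l t).continuousAt

/-- Controllability makes the response injective. -/
theorem eq_zero_of_response_eq_zero {A : Matrix (Fin n) (Fin n) ℝ} {B : Fin n → ℝ}
    (hAB : IsControllable A B) {l : Fin n → ℝ} (h : ∀ t, response (-A) B l t = 0) : l = 0 := by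
  -- These are the derivatives at 0. The vector is quantified inside because the induction replaces
  -- it by (-A)ᵀ l.
  have hk : ∀ k : ℕ, ∀ l : Fin n → ℝ, (∀ t, response (-A) B l t = 0) →
      l ⬝ᵥ ((-A) ^ k) *ᵥ B = 0 := by
    intro k
    induction k with
    | zero => intro l hl; simpa [response_apply] using hl 0
    | succ k ih =>
      intro l hl
      have h' : ∀ t, response (-A) B ((-A)ᵀ.mulVecLin l) t = 0 := fun t => by
        have h1 := hasDerivAt_response (-A) B l t
        rw [show response (-A) B l = fun _ => 0 from funext hl] at h1
        exact h1.unique (hasDerivAt_const t 0)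
      have := ih _ h'
      rw [pow_succ', ← mulVec_mulVec, dotProduct_mulVec, ← mulVec_transpose]
      exact this
  have hz : l ᵥ* controllabilityMatrix A B = 0 := by
    ext j
    have h1 : l ⬝ᵥ (A ^ (j : ℕ)) *ᵥ B = 0 := by
      have := hk j l h
      rcases Nat.even_or_odd (j : ℕ) with he | ho
      · rwa [he.neg_pow] at this
      · rwa [ho.neg_pow, neg_mulVec, dotProduct_neg, neg_eq_zero] at this
    simpa [vecMul, controllabilityMatrix, dotProduct] using h1
  have hli : LinearIndependent ℝ (controllabilityMatrix A B).row := by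
    rw [linearIndependent_iff_card_eq_finrank_span, Fintype.card_fin, Set.finrank,
      ← Matrix.rank_eq_finrank_span_row]
    exact hAB.symm
  exact Matrix.vecMul_injective_iff.2 hli (by simp only [hz, zero_vecMul])

/-- The imaginary parts of the roots of the characteristic polynomial of `A` are bounded by the
largest one. -/
theorem abs_im_le_of_aeval_charpoly {A : Matrix (Fin n) (Fin n) ℝ} {Ω : ℝ}
    (hΩ : IsGreatest (eigenvalueImParts A) Ω) (z : ℂ)
    (hz : Polynomial.aeval z ((-A)ᵀ).charpoly = 0) : |z.im| ≤ Ω := by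
  -- Since -z is an eigenvalue of A, this bounds one side; the conjugate root gives the other.
  have key : ∀ z : ℂ, Polynomial.aeval z ((-A)ᵀ).charpoly = 0 → -z.im ≤ Ω := by
    intro z hz
    apply hΩ.2
    refine ⟨-z, ?_, by simp⟩
    rw [charpoly_transpose] at hz
    have h1 : Module.End.HasEigenvalue
        (Matrix.toLin' ((-A).map (fun a => (a : ℂ)))) z := by
      rw [Module.End.hasEigenvalue_iff_isRoot_charpoly, Matrix.charpoly_toLin']
      rw [Polynomial.IsRoot, show (fun a : ℝ => (a : ℂ)) = (algebraMap ℝ ℂ) from rfl,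
        Matrix.charpoly_map, Polynomial.eval_map_algebraMap]
      exact hz
    obtain ⟨v, hv⟩ := h1.exists_hasEigenvector
    refine Module.End.hasEigenvalue_of_hasEigenvector (x := v)
      ((Module.End.hasEigenvector_iff).2 ⟨Module.End.mem_eigenspace_iff.2 ?_, hv.2⟩)
    have := hv.apply_eq_smul
    rw [show (-A).map (fun a : ℝ => (a : ℂ)) = -(A.map (fun a : ℝ => (a : ℂ))) by ext; simp,
      map_neg, LinearMap.neg_apply] at this
    rw [neg_smul, ← this, neg_neg]
  rw [abs_le]
  refine ⟨by linarith [key z hz], ?_⟩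
  have := key ((starRingEnd ℂ) z) (by rw [Polynomial.aeval_conj, hz, map_zero])
  simpa using this

/-- The spectrum of a real matrix is closed under conjugation, and `0 < n` makes it nonempty. -/
theorem imPart_nonneg {A : Matrix (Fin n) (Fin n) ℝ} {Ω : ℝ}
    (hΩ : IsGreatest (eigenvalueImParts A) Ω) (hn : 0 < n) : 0 ≤ Ω := by
  obtain ⟨z, hz⟩ := IsAlgClosed.exists_aeval_eq_zero ℂ ((-A)ᵀ).charpoly (by
    rw [Matrix.charpoly_degree_eq_dim]; simp; omega)
  exact (abs_nonneg _).trans (abs_im_le_of_aeval_charpoly hΩ z hz)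

/-- A nonzero response has fewer than `n` zeros on an interval of length less than `π / Ω`. -/
theorem card_zeros_response_lt {A : Matrix (Fin n) (Fin n) ℝ} {B : Fin n → ℝ} {Ω : ℝ}
    (hAB : IsControllable A B) (hΩ : IsGreatest (eigenvalueImParts A) Ω) {l : Fin n → ℝ}
    (hl : l ≠ 0) {a b : ℝ} (hab : a ≤ b) (hlt : Ω * (b - a) < Real.pi) (s : Finset ℝ)
    (hs : ∀ x ∈ s, x ∈ Set.Icc a b) (hz : ∀ x ∈ s, response (-A) B l x = 0) : s.card < n := by
  by_contra! hcard
  refine hl (eq_zero_of_response_eq_zero hAB ?_)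
  refine eq_zero_of_natDegree_le_card_zeros ((-A)ᵀ.mulVecLin) (response (-A) B)
    (hasDerivAt_response (-A) B) hab hlt n ((-A)ᵀ).charpoly
    (by rw [Matrix.charpoly_natDegree_eq_dim, Fintype.card_fin]) (Matrix.charpoly_monic _).ne_zero
    (abs_im_le_of_aeval_charpoly hΩ) l ?_ s hs hz hcard
  have : Polynomial.aeval ((-A)ᵀ.mulVecLin) ((-A)ᵀ).charpoly = 0 := by
    rw [← Matrix.toLin'_apply', ← Matrix.charpoly_toLin', LinearMap.aeval_self_charpoly]
  rw [this, LinearMap.zero_apply]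

/-- A nonzero response takes the values `± c` fewer than `2n` times on an interval of length
less than `π / Ω`. -/
theorem card_sq_response_eq_lt {A : Matrix (Fin n) (Fin n) ℝ} {B : Fin n → ℝ} {Ω : ℝ}
    (hA : IsUnit A.det) (hAB : IsControllable A B) (hΩ : IsGreatest (eigenvalueImParts A) Ω)
    {l : Fin n → ℝ} (hl : l ≠ 0) {a b : ℝ} (hab : a ≤ b) (hlt : Ω * (b - a) < Real.pi) (c : ℝ)
    (s : Finset ℝ) (hs : ∀ x ∈ s, x ∈ Set.Icc a b)
    (hz : ∀ x ∈ s, response (-A) B l x ^ 2 = c ^ 2) : s.card < 2 * n := by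
  -- Nonsingularity of A enters here: it makes the derivative of the response a nonzero response.
  have hl' : (-A)ᵀ.mulVecLin l ≠ 0 := by
    have hu : IsUnit (-A)ᵀ := (Matrix.isUnit_transpose _).2 ((Matrix.isUnit_iff_isUnit_det A).2 hA).neg
    intro h
    exact hl (Matrix.mulVec_injective_iff_isUnit.2 hu (by
      simp only [Matrix.mulVec_zero]
      exact h))
  -- The square treats c and -c together: (p²)' = 2pp' has at most 2(n - 1) zeros, hence at most 2n
  -- - 1 points. Counting the two values separately would only give 2n.
  obtain ⟨s', hs', hz', hcard⟩ := exists_finset_deriv_eq_zero (Set.ordConnected_Icc (a := a) (b := b))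
    (fun t _ => (hasDerivAt_response (-A) B l t).pow 2) (c ^ 2) s hs hz
  have h1 := card_zeros_response_lt hAB hΩ hl hab hlt
    (s'.filter fun x => response (-A) B l x = 0) (fun x hx => hs' x (Finset.mem_filter.1 hx).1)
    (fun x hx => (Finset.mem_filter.1 hx).2)
  have h2 := card_zeros_response_lt hAB hΩ hl' hab hlt
    (s'.filter fun x => response (-A) B ((-A)ᵀ.mulVecLin l) x = 0)
    (fun x hx => hs' x (Finset.mem_filter.1 hx).1) (fun x hx => (Finset.mem_filter.1 hx).2)
  have h3 : s' ⊆ (s'.filter fun x => response (-A) B l x = 0) ∪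
      (s'.filter fun x => response (-A) B ((-A)ᵀ.mulVecLin l) x = 0) := by
    intro x hx
    have := hz' x hx
    simp only [Finset.mem_union, Finset.mem_filter, hx, true_and]
    rcases mul_eq_zero.1 this with h | h
    · left
      simpa using h
    · exact Or.inr h
  have h4 := (Finset.card_le_card h3).trans (Finset.card_union_le _ _)
  omega

/-- Counting the points at which a nonzero response vanishes or takes one of finitely many values
up to sign. -/
theorem card_levels_le {A : Matrix (Fin n) (Fin n) ℝ} {B : Fin n → ℝ} {Ω : ℝ}
    (hA : IsUnit A.det) (hAB : IsControllable A B) (hΩ : IsGreatest (eigenvalueImParts A) Ω)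
    {l : Fin n → ℝ} (hl : l ≠ 0) {a b : ℝ} (hab : a ≤ b) (hlt : Ω * (b - a) < Real.pi)
    (L : Finset ℝ) (s : Finset ℝ) (hs : ∀ x ∈ s, x ∈ Set.Icc a b)
    (hz : ∀ x ∈ s, ∃ c ∈ L, response (-A) B l x ^ 2 = c ^ 2) :
    s.card ≤ L.card * (2 * n - 1) := by
  have hsub : s ⊆ L.biUnion fun c => s.filter fun x => response (-A) B l x ^ 2 = c ^ 2 := by
    intro x hx
    obtain ⟨c, hc, h⟩ := hz x hx
    simp only [Finset.mem_biUnion, Finset.mem_filter]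
    exact ⟨c, hc, hx, h⟩
  refine (Finset.card_le_card hsub).trans (Finset.card_biUnion_le_card_mul _ _ _ fun c _ => ?_)
  have := card_sq_response_eq_lt hA hAB hΩ hl hab hlt c
    (s.filter fun x => response (-A) B l x ^ 2 = c ^ 2)
    (fun x hx => hs x (Finset.mem_filter.1 hx).1) (fun x hx => (Finset.mem_filter.1 hx).2)
  omega

/-! ### Cutting the time interval -/

/-- A subset of `(0, T)` with at most `m` points in each interval of length `T / k` has at most
`m k` points. -/
theorem finite_and_ncard_le {T : ℝ} (hT : 0 < T) {Z : Set ℝ} (hZ : Z ⊆ Set.Ioo 0 T) {k m : ℕ}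
    (hk : 0 < k) (h : ∀ a b : ℝ, a ≤ b → b - a ≤ T / k → ∀ s : Finset ℝ, (∀ x ∈ s, x ∈ Z) →
      (∀ x ∈ s, x ∈ Set.Icc a b) → s.card ≤ m) : Z.Finite ∧ Z.ncard ≤ m * k := by
  have hk' : (0 : ℝ) < k := Nat.cast_pos.2 hk
  have hfin : ∀ s : Finset ℝ, (∀ x ∈ s, x ∈ Z) → s.card ≤ m * k := by
    intro s hs
    -- Points are sorted by the index ⌊xk/T⌋ of the piece containing them.
    have := Finset.card_le_mul_card_image_of_maps_to (s := s) (t := Finset.range k)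
      (f := fun x => ⌊x * k / T⌋₊) (fun x hx => by
        have hx' := hZ (hs x hx)
        rw [Finset.mem_range, Nat.floor_lt (by have := hx'.1; positivity),
          div_lt_iff₀ hT, mul_comm]
        exact mul_lt_mul_of_pos_left hx'.2 hk') m (fun j _ => by
        refine h (j * (T / k)) ((j + 1) * (T / k)) ?_ ?_ _
          (fun x hx => hs x (Finset.mem_filter.1 hx).1) (fun x hx => ?_)
        · have : 0 ≤ T / k := by positivity
          nlinarith
        · linarith
        · obtain ⟨hx1, hx2⟩ := Finset.mem_filter.1 hx
          have hx' := hZ (hs x hx1)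
          have h0 : 0 ≤ x * k / T := by have := hx'.1; positivity
          rw [Nat.floor_eq_iff h0, le_div_iff₀ hT, div_lt_iff₀ hT] at hx2
          rw [← mul_div_assoc, ← mul_div_assoc]
          exact ⟨(div_le_iff₀ hk').2 hx2.1, (le_div_iff₀ hk').2 hx2.2.le⟩)
    rwa [Finset.card_range] at this
  have hZfin : Z.Finite := by
    by_contra hinf
    obtain ⟨t, ht, htc⟩ := Set.Infinite.exists_subset_card_eq hinf (m * k + 1)
    have := hfin t (fun x hx => ht hx)
    omega
  refine ⟨hZfin, ?_⟩
  rw [Set.ncard_eq_toFinset_card Z hZfin]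
  exact hfin _ fun x hx => hZfin.mem_toFinset.1 hx

/-! ### Variation of constants -/

theorem IsControl.integrable {T : ℝ} {u : ℝ → ℝ} (hu : IsControl T u) :
    Integrable u (volume.restrict (Set.Icc 0 T)) :=
  ⟨hu.1, HasFiniteIntegral.of_bounded (C := 1) hu.2⟩

theorem IsControl.intervalIntegrable {T : ℝ} {u : ℝ → ℝ} (hu : IsControl T u) (hT : 0 ≤ T) :
    IntervalIntegrable u volume 0 T :=
  (intervalIntegrable_iff_integrableOn_Icc_of_le hT).2 hu.integrable

/-- Integration by parts against an antiderivative. -/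
theorem integral_deriv_mul_antideriv {φ φ' g G : ℝ → ℝ} {c τ : ℝ} (hτ : 0 ≤ τ)
    (hφ : ∀ t, HasDerivAt φ (φ' t) t) (hφ' : Continuous φ')
    (hg : IntervalIntegrable g volume 0 τ)
    (hG : ∀ t ∈ Set.Icc 0 τ, G t = c + ∫ s in (0 : ℝ)..t, g s) :
    ∫ s in (0 : ℝ)..τ, (φ' s * G s + φ s * g s) = φ τ * G τ - φ 0 * c := by
  have hder : deriv φ = φ' := funext fun t => (hφ t).deriv
  have hC1 : ContDiff ℝ 1 φ :=
    contDiff_one_iff_deriv.2 ⟨fun t => (hφ t).differentiableAt, hder ▸ hφ'⟩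
  -- As g is only integrable, its primitive is only absolutely continuous; integration by parts
  -- holds in that class.
  have hφac : AbsolutelyContinuousOnInterval φ 0 τ := hC1.contDiffOn.absolutelyContinuousOnInterval
  have hGac : AbsolutelyContinuousOnInterval (fun t => ∫ s in (0 : ℝ)..t, g s) 0 τ :=
    hg.absolutelyContinuousOnInterval_intervalIntegral (by simp)
  have h := hφac.integral_deriv_mul_eq_sub hGac
  have hφint : IntervalIntegrable φ' volume 0 τ := hφ'.intervalIntegrable _ _
  have hφ0 : ∫ s in (0 : ℝ)..τ, φ' s = φ τ - φ 0 :=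
    intervalIntegral.integral_eq_sub_of_hasDerivAt (fun t _ => hφ t) hφint
  have hGτ := hG τ ⟨hτ, le_rfl⟩
  have hcongr : ∫ s in (0 : ℝ)..τ, (φ' s * G s + φ s * g s) =
      ∫ s in (0 : ℝ)..τ, (c * φ' s + (deriv φ s * (∫ r in (0 : ℝ)..s, g r) +
        φ s * deriv (fun t => ∫ r in (0 : ℝ)..t, g r) s)) := by
    apply intervalIntegral.integral_congr_ae
    filter_upwards [hg.ae_hasDerivAt_integral] with s hs hs'
    have hs1 : s ∈ Set.uIcc 0 τ := Set.uIoc_subset_uIcc hs'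
    rw [(hs hs1 0 (by simp)).deriv, hder, hG s (by rwa [Set.uIcc_of_le hτ] at hs1)]
    ring
  rw [hcongr, intervalIntegral.integral_add (hφint.const_mul c), h,
    intervalIntegral.integral_const_mul, hφ0, hGτ]
  · simp only [intervalIntegral.integral_same]
    ring
  · exact (hφac.intervalIntegrable_deriv.mul_continuousOn hGac.continuousOn).add
      (hGac.intervalIntegrable_deriv.continuousOn_mul hφac.continuousOn)

/-- The coefficients do not involve y, so a time-dependent y(t) can be handled by n scalar
integrations by parts. -/
theorem sum_response_single_mul (M : Matrix (Fin n) (Fin n) ℝ) (l y : Fin n → ℝ) (t : ℝ) :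
    ∑ i, response M (Pi.single i 1) l t * y i = response M y l t := by
  simp only [response_apply, dotProduct_mulVec _ _ y, dotProduct_mulVec _ _ (Pi.single _ (1 : ℝ)),
    dotProduct_single, mul_one]
  rfl

/-- Integration by parts for `λᵀ e^{tM} y(t)`. -/
theorem integral_response_antideriv (M : Matrix (Fin n) (Fin n) ℝ) (l : Fin n → ℝ)
    {y g : ℝ → Fin n → ℝ} {y₀ : Fin n → ℝ} {τ : ℝ} (hτ : 0 ≤ τ)
    (hg : ∀ i, IntervalIntegrable (fun s => g s i) volume 0 τ)
    (hy : ∀ i, ∀ t ∈ Set.Icc 0 τ, y t i = y₀ i + ∫ s in (0 : ℝ)..t, g s i) :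
    ∫ s in (0 : ℝ)..τ, (response M (y s) (Mᵀ.mulVecLin l) s + response M (g s) l s) =
      response M (y τ) l τ - l ⬝ᵥ y₀ := by
  have hcont : ∀ i, ContinuousOn (fun s => y s i) (Set.uIcc 0 τ) := fun i =>
    ContinuousOn.congr (f := fun t => y₀ i + ∫ s in (0 : ℝ)..t, g s i)
      (continuousOn_const.add
        (intervalIntegral.continuousOn_primitive_interval' (hg i) (by simp)))
      (fun t ht => hy i t (by rwa [Set.uIcc_of_le hτ] at ht))
  have h := fun i => integral_deriv_mul_antideriv hτ (hasDerivAt_response M (Pi.single i 1) l)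
    (continuous_response M _ _) (hg i) (hy i)
  simp only [← sum_response_single_mul M _ (y _), ← sum_response_single_mul M _ (g _)]
  simp only [← Finset.sum_add_distrib]
  rw [intervalIntegral.integral_finsetSum, Finset.sum_congr rfl fun i _ => h i,
    Finset.sum_sub_distrib]
  · congr 1
    rw [sum_response_single_mul]
    simp [response_apply]
  · intro i _
    exact (((continuous_response M _ _).continuousOn.mul (hcont i)).intervalIntegrable).add
      ((hg i).continuousOn_mul (continuous_response M _ _).continuousOn)

theorem response_add (M : Matrix (Fin n) (Fin n) ℝ) (x y l : Fin n → ℝ) (t : ℝ) :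
    response M (x + y) l t = response M x l t + response M y l t := by
  simp only [response_apply, mulVec_add, dotProduct_add]

theorem response_smul (M : Matrix (Fin n) (Fin n) ℝ) (c : ℝ) (x l : Fin n → ℝ) (t : ℝ) :
    response M (c • x) l t = c * response M x l t := by
  simp only [response_apply, mulVec_smul, dotProduct_smul, smul_eq_mul]

section

attribute [local instance] Matrix.linftyOpNormedRing Matrix.linftyOpNormedAlgebra

/-- M commutes with its exponential. This moves the derivative from λ to the state, where it cancels
the drift Ax. -/
theorem response_transpose_mulVec (M : Matrix (Fin n) (Fin n) ℝ) (x l : Fin n → ℝ) (t : ℝ) :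
    response M x (Mᵀ.mulVecLin l) t = response M (M *ᵥ x) l t := by
  have hc : Commute M (NormedSpace.exp (t • M)) :=
    ((Commute.refl M).smul_right t).exp_right
  simp only [response_apply, mulVecLin_apply, mulVec_mulVec, mulVec_transpose]
  rw [← hc.eq, ← mulVec_mulVec, ← dotProduct_mulVec]

theorem exp_smul_mulVec_exp_neg (A : Matrix (Fin n) (Fin n) ℝ) (x : Fin n → ℝ) (t : ℝ) :
    NormedSpace.exp (t • A) *ᵥ NormedSpace.exp (t • (-A)) *ᵥ x = x := by
  rw [mulVec_mulVec, ← Matrix.exp_add_of_commute _ _ (by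
    rw [smul_neg]; exact (Commute.refl _).neg_right), smul_neg, add_neg_cancel,
    NormedSpace.exp_zero, one_mulVec]

end

/-- Variation of constants: `u` is feasible for `ξ` iff `∫₀ᵀ e^{-At} B u(t) dt = -ξ`, tested
against all vectors. -/
theorem mem_feasible_iff {A : Matrix (Fin n) (Fin n) ℝ} {B : Fin n → ℝ} {T : ℝ} (hT : 0 ≤ T)
    {ξ : Fin n → ℝ} {u : ℝ → ℝ} :
    u ∈ feasible A B T ξ ↔ IsControl T u ∧
      ∀ l, ∫ t in (0 : ℝ)..T, u t * response (-A) B l t = -(l ⬝ᵥ ξ) := by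
  constructor
  · rintro ⟨hu, x, ⟨hx, hxint⟩, hxT⟩
    refine ⟨hu, fun l => ?_⟩
    have hui := hu.intervalIntegrable hT
    have hxi : ∀ i, ContinuousOn (fun s => x s i) (Set.uIcc 0 T) := by
      rw [Set.uIcc_of_le hT]
      exact fun i => (continuous_apply i).comp_continuousOn hx
    have hgi : ∀ i, IntervalIntegrable (fun s => (A *ᵥ (x s) + u s • B) i) volume 0 T := by
      intro i
      simp only [Pi.add_apply, Pi.smul_apply, smul_eq_mul, mulVec, dotProduct]
      exact (continuousOn_finsetSum _ fun j _ =>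
        continuousOn_const.mul (hxi j)).intervalIntegrable.add (hui.mul_const _)
    have hg : IntervalIntegrable (fun s => A *ᵥ (x s) + u s • B) volume 0 T := by
      rw [intervalIntegrable_iff]
      exact Integrable.of_eval fun i => intervalIntegrable_iff.1 (hgi i)
    -- The integrand is λᵀ e^{-sA}(-Ax + Ax + uB), and the boundary term at T vanishes because x(T)
    -- = 0.
    have h := integral_response_antideriv (-A) l hT hgi (y := x) (y₀ := ξ) (by
      intro i t ht
      have hsub : Set.uIcc 0 t ⊆ Set.uIcc 0 T := by
        rw [Set.uIcc_of_le ht.1, Set.uIcc_of_le hT]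
        exact Set.Icc_subset_Icc_right ht.2
      have h1 := congrFun (hxint t ht) i
      rw [Pi.add_apply] at h1
      rw [h1]
      congr 1
      exact ((ContinuousLinearMap.proj (R := ℝ) (φ := fun _ : Fin n => ℝ) i).intervalIntegral_comp_comm
        (hg.mono_set hsub)).symm)
    rw [hxT] at h
    rw [show response (-A) 0 l T = 0 by simp [response_apply], zero_sub] at h
    rw [← h]
    congr 1
    ext s
    rw [response_transpose_mulVec, ← response_add, ← response_smul, neg_mulVec,
      neg_add_cancel_left]
  · rintro ⟨hu, hint⟩
    refine ⟨hu, ?_⟩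
    have hui := hu.intervalIntegrable hT
    set g : ℝ → Fin n → ℝ := fun s => u s • (NormedSpace.exp (s • (-A)) *ᵥ B) with hg
    have hgi' : ∀ i s, g s i = u s * response (-A) B (Pi.single i 1) s := by
      intro i s
      simp [hg, response_apply]
    have hgi : ∀ i, IntervalIntegrable (fun s => g s i) volume 0 T := by
      intro i
      simp only [hgi']
      exact hui.mul_continuousOn (continuous_response _ _ _).continuousOn
    -- Here y(t) = ξ + ∫₀ᵗ e^{-sA} B u ds, so x = e^{tA} y is the trajectory and the hypothesis says
    -- y(T) = 0.
    set y : ℝ → Fin n → ℝ := fun t i => ξ i + ∫ s in (0 : ℝ)..t, g s i with hy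
    have hyc : ∀ i, ContinuousOn (fun t => y t i) (Set.uIcc 0 T) := fun i =>
      continuousOn_const.add
        (intervalIntegral.continuousOn_primitive_interval' (hgi i) (by simp))
    set x : ℝ → Fin n → ℝ := fun t => NormedSpace.exp (t • A) *ᵥ y t with hx
    have hxj : ∀ j t, x t j = response A (y t) (Pi.single j 1) t := by
      intro j t
      simp [hx, response_apply]
    have hxc : ContinuousOn x (Set.uIcc 0 T) := by
      rw [continuousOn_pi]
      intro j
      simp only [hxj, ← sum_response_single_mul A _ (y _)]
      exact continuousOn_finsetSum _ fun i _ =>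
        (continuous_response _ _ _).continuousOn.mul (hyc i)
    have hyT : y T = 0 := by
      ext i
      simp only [hy, hgi', hint]
      simp
    have hG : IntervalIntegrable (fun s => A *ᵥ (x s) + u s • B) volume 0 T := by
      refine IntervalIntegrable.add ?_ ?_
      · exact ((A.mulVecLin.continuous_of_finiteDimensional).comp_continuousOn
          hxc).intervalIntegrable
      · exact ⟨hui.1.smul_const B, hui.2.smul_const B⟩
    refine ⟨x, ⟨by rwa [Set.uIcc_of_le hT] at hxc, fun t ht => ?_⟩, by simp [hx, hyT]⟩
    have hsub : Set.uIcc 0 t ⊆ Set.uIcc 0 T := by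
      rw [Set.uIcc_of_le ht.1, Set.uIcc_of_le hT]
      exact Set.Icc_subset_Icc_right ht.2
    ext j
    have h := integral_response_antideriv A (Pi.single j 1) (y := y) (y₀ := ξ) (g := g) ht.1
      (fun i => (hgi i).mono_set hsub) (fun i s _ => rfl)
    have h2 := (ContinuousLinearMap.proj (R := ℝ) (φ := fun _ : Fin n => ℝ) j).intervalIntegral_comp_comm
        (hG.mono_set hsub)
    rw [Pi.add_apply, hxj, eq_add_of_sub_eq h.symm, add_comm, single_dotProduct, one_mul]
    congr 1
    refine Eq.trans ?_ h2
    congr 1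
    ext s
    simp only [ContinuousLinearMap.proj_apply, Pi.add_apply]
    congr 1
    · rw [response_apply, mulVecLin_apply, mulVec_transpose, ← dotProduct_mulVec,
        single_dotProduct, one_mul]
    · rw [hg, response_smul, response_apply, exp_smul_mulVec_exp_neg, single_dotProduct, one_mul]
      rfl

/-! ### Separation and the minimum principle -/

variable {N : ℕ}

/-- In finite dimension, a point outside a nonempty convex set is separated from it by a nonzero
functional. -/
theorem exists_dual_le_of_notMem_convex {E : Type*} [NormedAddCommGroup E] [NormedSpace ℝ E]
    [FiniteDimensional ℝ E] {C : Set E} (hC : Convex ℝ C) (hne : C.Nonempty) {x : E} (hx : x ∉ C) :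
    ∃ f : E →ₗ[ℝ] ℝ, f ≠ 0 ∧ ∀ y ∈ C, f x ≤ f y := by
  by_cases hint : (interior C).Nonempty
  · obtain ⟨f, hf, h⟩ := geometric_hahn_banach_of_nonempty_interior_point hC
      (fun h => hx (interior_subset h)) hint
    refine ⟨-(f : E →ₗ[ℝ] ℝ), fun h0 => hf ?_, fun y hy => by simpa using h y hy⟩
    ext y
    simpa using LinearMap.congr_fun h0 y
  -- With empty interior, C lies in a proper affine subspace. A nonzero functional vanishing on its
  -- direction is constant on C, and a choice of sign suffices.
  · rw [hC.interior_nonempty_iff_affineSpan_eq_top,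
      ← AffineSubspace.direction_eq_top_iff_of_nonempty (hne.mono (subset_affineSpan ℝ C))] at hint
    obtain ⟨f, hf, hker⟩ := Submodule.exists_le_ker_of_lt_top _ (lt_top_iff_ne_top.2 hint)
    obtain ⟨y₀, hy₀⟩ := hne
    have hconst : ∀ y ∈ C, f y = f y₀ := fun y hy => by
      have := hker (AffineSubspace.vsub_mem_direction (subset_affineSpan ℝ C hy)
        (subset_affineSpan ℝ C hy₀))
      rwa [LinearMap.mem_ker, vsub_eq_sub, map_sub, sub_eq_zero] at this
    rcases le_total (f x) (f y₀) with h | h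
    · exact ⟨f, hf, fun y hy => by rwa [hconst y hy]⟩
    · exact ⟨-f, neg_ne_zero.2 hf, fun y hy => by simpa [hconst y hy] using h⟩

/-- The running cost `∑ i, w i (|v - U i| + |v + U i|)`. -/
def runningCost (U w : Fin N → ℝ) (v : ℝ) : ℝ := ∑ i, w i * (|v - U i| + |v + U i|)

theorem continuous_runningCost (U w : Fin N → ℝ) : Continuous (runningCost U w) := by
  unfold runningCost
  fun_prop

theorem runningCost_convex {U w : Fin N → ℝ} (hw : ∀ i, 0 < w i) {a b : ℝ} (ha : 0 ≤ a)
    (hb : 0 ≤ b) (hab : a + b = 1) (u v : ℝ) :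
    runningCost U w (a * u + b * v) ≤ a * runningCost U w u + b * runningCost U w v := by
  unfold runningCost
  rw [Finset.mul_sum, Finset.mul_sum, ← Finset.sum_add_distrib]
  refine Finset.sum_le_sum fun i _ => ?_
  have h : ∀ x y : ℝ, |a * x + b * y| ≤ a * |x| + b * |y| := fun x y => by
    refine (abs_add_le _ _).trans_eq ?_
    rw [abs_mul, abs_mul, abs_of_nonneg ha, abs_of_nonneg hb]
  have h1 := h (u - U i) (v - U i)
  have h2 := h (u + U i) (v + U i)
  rw [show a * (u - U i) + b * (v - U i) = a * u + b * v - U i by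
    linear_combination -U i * hab] at h1
  rw [show a * (u + U i) + b * (v + U i) = a * u + b * v + U i by
    linear_combination U i * hab] at h2
  have := mul_le_mul_of_nonneg_left (add_le_add h1 h2) (hw i).le
  linarith

theorem IsControl.integrable_runningCost {T : ℝ} {u : ℝ → ℝ} (hu : IsControl T u)
    (U w : Fin N → ℝ) :
    Integrable (fun t => runningCost U w (u t)) (volume.restrict (Set.Icc 0 T)) := by
  unfold runningCost
  refine integrable_finsetSum _ fun i _ => Integrable.const_mul ?_ _
  exact (hu.integrable.sub (integrable_const _)).abs.add
    (hu.integrable.add (integrable_const _)).abs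

theorem IsControl.cost_eq {T : ℝ} (hT : 0 ≤ T) {u : ℝ → ℝ} (hu : IsControl T u)
    (U w : Fin N → ℝ) : cost U w T u = ∫ t in Set.Icc 0 T, runningCost U w (u t) := by
  have h1 : ∀ i, Integrable (fun t => |u t - U i|) (volume.restrict (Set.Icc 0 T)) := fun i =>
    (hu.integrable.sub (integrable_const _)).abs
  have h2 : ∀ i, Integrable (fun t => |u t + U i|) (volume.restrict (Set.Icc 0 T)) := fun i =>
    (hu.integrable.add (integrable_const _)).abs
  unfold cost runningCost
  have h3 : ∀ i, Integrable (fun t => w i * (|u t - U i| + |u t + U i|))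
      (volume.restrict (Set.Icc 0 T)) := fun i => ((h1 i).add (h2 i)).const_mul _
  rw [integral_finsetSum _ fun i _ => h3 i]
  refine Finset.sum_congr rfl fun i _ => ?_
  rw [integral_const_mul, integral_add (h1 i) (h2 i), intervalIntegral.integral_of_le hT,
    intervalIntegral.integral_of_le hT, integral_Icc_eq_integral_Ioc, integral_Icc_eq_integral_Ioc]

theorem IsControl.integrable_mul_response {T : ℝ} {u : ℝ → ℝ} (hu : IsControl T u)
    (M : Matrix (Fin n) (Fin n) ℝ) (B l : Fin n → ℝ) :
    Integrable (fun t => u t * response M B l t) (volume.restrict (Set.Icc 0 T)) :=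
  IntegrableOn.mul_continuousOn hu.integrable (continuous_response M B l).continuousOn isCompact_Icc

/-- The linear functional value `∫₀ᵀ e^{tM} B u(t) dt`, by coordinates. -/
noncomputable def steering (M : Matrix (Fin n) (Fin n) ℝ) (B : Fin n → ℝ) (T : ℝ) (u : ℝ → ℝ) :
    Fin n → ℝ := fun i => ∫ t in Set.Icc 0 T, u t * response M B (Pi.single i 1) t

theorem dotProduct_steering {T : ℝ} {u : ℝ → ℝ} (hu : IsControl T u)
    (M : Matrix (Fin n) (Fin n) ℝ) (B l : Fin n → ℝ) :
    l ⬝ᵥ steering M B T u = ∫ t in Set.Icc 0 T, u t * response M B l t := by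
  unfold steering dotProduct
  simp only [← integral_const_mul]
  rw [← integral_finsetSum _ fun i _ => (hu.integrable_mul_response M B _).const_mul _]
  congr 1
  ext t
  have : response M B l = ∑ i, l i • response M B (Pi.single i 1) := by
    conv_lhs => rw [pi_eq_sum_univ' l]
    simp only [map_sum, map_smul]
  rw [this, Finset.sum_apply, Finset.mul_sum]
  exact Finset.sum_congr rfl fun i _ => by simp; ring

theorem mem_feasible_iff_steering {A : Matrix (Fin n) (Fin n) ℝ} {B : Fin n → ℝ} {T : ℝ}
    (hT : 0 ≤ T) {ξ : Fin n → ℝ} {u : ℝ → ℝ} :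
    u ∈ feasible A B T ξ ↔ IsControl T u ∧ steering (-A) B T u = -ξ := by
  rw [mem_feasible_iff hT]
  refine and_congr_right fun hu => ?_
  simp only [intervalIntegral.integral_of_le hT, ← integral_Icc_eq_integral_Ioc,
    ← dotProduct_steering hu, ← dotProduct_neg]
  exact ⟨fun h => dotProduct_eq _ _ fun l => by simpa [dotProduct_comm] using h l, fun h l => by rw [h]⟩

theorem IsControl.convexComb {T : ℝ} {u v : ℝ → ℝ} (hu : IsControl T u) (hv : IsControl T v)
    {a b : ℝ} (ha : 0 ≤ a) (hb : 0 ≤ b) (hab : a + b = 1) :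
    IsControl T (fun t => a * u t + b * v t) := by
  refine ⟨(hu.1.const_mul a).add (hv.1.const_mul b), ?_⟩
  filter_upwards [hu.2, hv.2] with t h1 h2
  rw [abs_le] at *
  constructor <;> nlinarith

/-- Multiplier rule: an optimal control minimizes a nontrivial combination of the cost and of the
steering functional over all controls. -/
theorem IsOptimal.exists_multiplier {A : Matrix (Fin n) (Fin n) ℝ} {B : Fin n → ℝ} {T : ℝ}
    (hT : 0 ≤ T) {U w : Fin N → ℝ} (hw : ∀ i, 0 < w i) {ξ : Fin n → ℝ} {u : ℝ → ℝ}
    (hopt : IsOptimal A B U w T ξ u) :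
    ∃ (c : ℝ) (l : Fin n → ℝ), 0 ≤ c ∧ (c ≠ 0 ∨ l ≠ 0) ∧ ∀ v, IsControl T v →
      c * cost U w T u + ∫ t in Set.Icc 0 T, u t * response (-A) B l t ≤
        c * cost U w T v + ∫ t in Set.Icc 0 T, v t * response (-A) B l t := by
  obtain ⟨hfeas, hmin⟩ := hopt
  obtain ⟨hu, huξ⟩ := (mem_feasible_iff_steering hT).1 hfeas
  -- The strict inequality keeps the optimal point outside C, and the unbounded first coordinate
  -- forces c ≥ 0.
  let C : Set (ℝ × (Fin n → ℝ)) :=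
    {p | ∃ v, IsControl T v ∧ cost U w T v < p.1 ∧ p.2 = steering (-A) B T v}
  have hCmem : ∀ v, IsControl T v → ∀ ε > 0, (cost U w T v + ε, steering (-A) B T v) ∈ C :=
    fun v hv ε hε => ⟨v, hv, lt_add_of_pos_right _ hε, rfl⟩
  have hconv : Convex ℝ C := by
    rintro ⟨p, x⟩ ⟨v, hv, hp, hx⟩ ⟨q, y⟩ ⟨v', hv', hq, hy⟩ a b ha hb hab
    simp only at hp hx hq hy
    have hc := hv.convexComb hv' ha hb hab
    refine ⟨fun t => a * v t + b * v' t, hc, ?_, ?_⟩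
    · simp only [Prod.fst_add, Prod.smul_fst, smul_eq_mul]
      have h1 : cost U w T (fun t => a * v t + b * v' t) ≤ a * cost U w T v + b * cost U w T v' := by
        rw [hc.cost_eq hT, hv.cost_eq hT, hv'.cost_eq hT, ← integral_const_mul,
          ← integral_const_mul, ← integral_add ((hv.integrable_runningCost U w).const_mul _)
          ((hv'.integrable_runningCost U w).const_mul _)]
        exact integral_mono (hc.integrable_runningCost U w)
          (((hv.integrable_runningCost U w).const_mul _).add
          ((hv'.integrable_runningCost U w).const_mul _))
          fun t => runningCost_convex hw ha hb hab _ _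
      rcases ha.eq_or_lt with rfl | ha'
      · have : b = 1 := by linarith
        subst this
        linarith
      · have := mul_lt_mul_of_pos_left hp ha'
        have := mul_le_mul_of_nonneg_left hq.le hb
        linarith
    · ext i
      simp only [Prod.snd_add, Prod.smul_snd, hx, hy, steering, Pi.add_apply, Pi.smul_apply,
        smul_eq_mul, ← integral_const_mul]
      rw [← integral_add ((hv.integrable_mul_response _ B _).const_mul _)
        ((hv'.integrable_mul_response _ B _).const_mul _)]
      congr 1
      ext t
      ring
  have hnot : (cost U w T u, -ξ) ∉ C := by
    rintro ⟨v, hv, hlt, heq⟩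
    exact absurd (hmin v ((mem_feasible_iff_steering hT).2 ⟨hv, heq.symm⟩)) (not_le.2 hlt)
  obtain ⟨f, hf, hle⟩ := exists_dual_le_of_notMem_convex hconv ⟨_, hCmem u hu 1 one_pos⟩ hnot
  let l : Fin n → ℝ := fun i => f (0, Pi.single i 1)
  have hfval : ∀ a x, f (a, x) = f (1, 0) * a + l ⬝ᵥ x := by
    intro a x
    have h1 : ((a, x) : ℝ × (Fin n → ℝ)) = a • (1, 0) + ∑ i, x i • (0, Pi.single i 1) := by
      ext j
      · simp [Prod.fst_sum]
      · simp [Prod.snd_sum, Finset.sum_apply, Pi.single_apply]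
    rw [h1, map_add, map_smul, map_sum]
    simp only [map_smul, smul_eq_mul, dotProduct, l]
    rw [mul_comm]
    congr 1
    exact Finset.sum_congr rfl fun i _ => mul_comm _ _
  have hle' : ∀ v, IsControl T v → ∀ ε > 0, f (1, 0) * cost U w T u + l ⬝ᵥ steering (-A) B T u ≤
      f (1, 0) * (cost U w T v + ε) + l ⬝ᵥ steering (-A) B T v := by
    intro v hv ε hε
    have := hle _ (hCmem v hv ε hε)
    rwa [hfval (cost U w T u), hfval (_ + _), ← huξ] at this
  have hc0 : 0 ≤ f (1, 0) := by
    have := hle' u hu 1 one_pos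
    linarith
  refine ⟨f (1, 0), l, hc0, ?_, fun v hv => ?_⟩
  · by_contra! h
    refine hf (LinearMap.ext fun p => ?_)
    rw [hfval p.1 p.2, h.1, h.2]
    simp
  · rw [← dotProduct_steering hu, ← dotProduct_steering hv]
    refine le_of_forall_pos_le_add fun ε hε => ?_
    have hpos : 0 < f (1, 0) + 1 := by linarith
    -- Dividing by c + 1 rather than c also covers c = 0.
    have h1 := hle' v hv (ε / (f (1, 0) + 1)) (by positivity)
    have h2 : f (1, 0) * (ε / (f (1, 0) + 1)) ≤ ε := by
      rw [mul_div_assoc', div_le_iff₀ hpos]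
      nlinarith
    linarith

/-- Pointwise minimum principle. -/
theorem ae_le_of_integral_le {T : ℝ} (hT : 0 ≤ T) {U w : Fin N → ℝ} {u : ℝ → ℝ}
    (hu : IsControl T u) (M : Matrix (Fin n) (Fin n) ℝ) (B l : Fin n → ℝ) (c : ℝ)
    (h : ∀ v, IsControl T v →
      c * cost U w T u + ∫ t in Set.Icc 0 T, u t * response M B l t ≤
        c * cost U w T v + ∫ t in Set.Icc 0 T, v t * response M B l t)
    {d : ℝ} (hd : |d| ≤ 1) : ∀ᵐ t ∂(volume.restrict (Set.Icc 0 T)),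
      c * runningCost U w (u t) + u t * response M B l t ≤
        c * runningCost U w d + d * response M B l t := by
  let H : ℝ → ℝ → ℝ := fun t v => c * runningCost U w v + v * response M B l t
  have hHint : ∀ v, IsControl T v → Integrable (fun t => H t (v t))
      (volume.restrict (Set.Icc 0 T)) := fun v hv =>
    ((hv.integrable_runningCost U w).const_mul c).add (hv.integrable_mul_response M B l)
  have hHval : ∀ v, IsControl T v → c * cost U w T v +
      ∫ t in Set.Icc 0 T, v t * response M B l t = ∫ t in Set.Icc 0 T, H t (v t) := by
    intro v hv
    rw [hv.cost_eq hT, ← integral_const_mul, ← integral_add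
      ((hv.integrable_runningCost U w).const_mul c) (hv.integrable_mul_response M B l)]
  have hmH : ∀ g : ℝ → ℝ, Measurable g → Measurable fun t => H t (g t) := fun g hg =>
    (((continuous_runningCost U w).measurable.comp hg).const_mul c).add
      (hg.mul (continuous_response M B l).measurable)
  set u' := hu.1.mk u with hu'
  have hu'm : Measurable u' := hu.1.stronglyMeasurable_mk.measurable
  have hae : u =ᵐ[volume.restrict (Set.Icc 0 T)] u' := hu.1.ae_eq_mk
  -- The competitor switches to d exactly where d does better; using the measurable representative
  -- of u keeps it measurable.
  let v : ℝ → ℝ := fun t => if H t d < H t (u' t) then d else u' t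
  have hvm : Measurable v :=
    Measurable.ite (measurableSet_lt (hmH _ measurable_const) (hmH _ hu'm)) measurable_const hu'm
  have hv : IsControl T v := by
    refine ⟨hvm.aestronglyMeasurable, ?_⟩
    filter_upwards [hu.2, hae] with t h1 h2
    simp only [v]
    split_ifs
    · exact hd
    · rwa [← h2]
  have hvd : ∀ t, H t (v t) ≤ H t d := by
    intro t
    simp only [v]
    split_ifs with h1
    · exact le_rfl
    · exact not_lt.1 h1
  have hvu : ∀ t, H t (v t) ≤ H t (u' t) := by
    intro t
    simp only [v]
    split_ifs with h1
    · exact h1.le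
    · exact le_rfl
  have hnn : 0 ≤ᵐ[volume.restrict (Set.Icc 0 T)] fun t => H t (u t) - H t (v t) := by
    filter_upwards [hae] with t ht
    have := hvu t
    rw [← ht] at this
    exact sub_nonneg.2 this
  have hi : ∫ t in Set.Icc 0 T, (H t (u t) - H t (v t)) = 0 := by
    refine le_antisymm ?_ (integral_nonneg_of_ae hnn)
    rw [integral_sub (hHint u hu) (hHint v hv), ← hHval u hu, ← hHval v hv]
    linarith [h v hv]
  have := (integral_eq_zero_iff_of_nonneg_ae hnn ((hHint u hu).sub (hHint v hv))).1 hi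
  filter_upwards [this] with t ht
  have h1 := hvd t
  have h2 : H t (u t) - H t (v t) = 0 := ht
  simp only [H] at h1 h2
  linarith

/-! ### Slopes and minimizers of the running cost -/

/-- The slope `2 ∑_{i < k} w i` of the running cost just below `U k`. -/
def slope (w : Fin N → ℝ) (k : ℕ) : ℝ := ∑ i : Fin N, if (i : ℕ) < k then 2 * w i else 0

theorem slope_zero (w : Fin N → ℝ) : slope w 0 = 0 := by simp [slope]

theorem slope_pos {w : Fin N → ℝ} (hw : ∀ i, 0 < w i) (hN : 0 < N) {k : ℕ} (hk : 0 < k) :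
    0 < slope w k := by
  refine Finset.sum_pos' (fun i _ => ?_) ⟨⟨0, hN⟩, Finset.mem_univ _, ?_⟩
  · split_ifs
    · linarith [hw i]
    · exact le_rfl
  · simp [hk, hw]

theorem runningCost_neg (U w : Fin N → ℝ) (v : ℝ) : runningCost U w (-v) = runningCost U w v := by
  unfold runningCost
  refine Finset.sum_congr rfl fun i _ => ?_
  rw [show -v - U i = -(v + U i) by ring, show -v + U i = -(v - U i) by ring, abs_neg, abs_neg,
    add_comm]

/-- Subgradient inequality to the right of `U k`. -/
theorem runningCost_ge_right {U w : Fin N → ℝ} (hw : ∀ i, 0 < w i) (hU : StrictMono U)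
    (hU0 : ∀ i, 0 ≤ U i) (k : Fin N) {v : ℝ} (hv : U k ≤ v) :
    runningCost U w (U k) + slope w (k + 1) * (v - U k) ≤ runningCost U w v := by
  unfold runningCost slope
  rw [Finset.sum_mul, ← Finset.sum_add_distrib]
  refine Finset.sum_le_sum fun i _ => ?_
  have h1 := hU0 i
  have h2 := hU0 k
  rw [abs_of_nonneg (by linarith : 0 ≤ v + U i), abs_of_nonneg (by linarith : 0 ≤ U k + U i)]
  split_ifs with hik
  · have h3 : U i ≤ U k := hU.monotone (Fin.le_def.2 (by omega))
    rw [abs_of_nonneg (by linarith : 0 ≤ v - U i), abs_of_nonneg (by linarith : 0 ≤ U k - U i)]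
    linarith
  · have h3 : U k ≤ U i := hU.monotone (Fin.le_def.2 (by omega))
    rw [abs_of_nonpos (by linarith : U k - U i ≤ 0)]
    have h4 := neg_le_abs (v - U i)
    have := mul_le_mul_of_nonneg_left (add_le_add_left h4 (v + U i)) (hw i).le
    linarith

/-- Subgradient inequality at `U k`, with the slope to the left of it. -/
theorem runningCost_ge_left {U w : Fin N → ℝ} (hw : ∀ i, 0 < w i) (hU : StrictMono U)
    (hU0 : ∀ i, 0 ≤ U i) (k : Fin N) (v : ℝ) :
    runningCost U w (U k) + slope w k * (v - U k) ≤ runningCost U w v := by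
  unfold runningCost slope
  rw [Finset.sum_mul, ← Finset.sum_add_distrib]
  refine Finset.sum_le_sum fun i _ => ?_
  have h1 := hU0 i
  have h2 := hU0 k
  rw [abs_of_nonneg (by linarith : 0 ≤ U k + U i)]
  have h5 := le_abs_self (v + U i)
  split_ifs with hik
  · have h3 : U i ≤ U k := hU.monotone (Fin.le_def.2 (by omega))
    rw [abs_of_nonneg (by linarith : 0 ≤ U k - U i)]
    have h4 := le_abs_self (v - U i)
    have := mul_le_mul_of_nonneg_left (add_le_add h4 h5) (hw i).le
    linarith
  · have h3 : U k ≤ U i := hU.monotone (Fin.le_def.2 (by omega))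
    rw [abs_of_nonpos (by linarith : U k - U i ≤ 0)]
    have h4 := neg_le_abs (v - U i)
    have := mul_le_mul_of_nonneg_left (add_le_add h4 h5) (hw i).le
    linarith

/-- `d` is the only minimizer over `[-1, 1]` of `v ↦ runningCost v - p v`. -/
def IsStrictMinimizer (U w : Fin N → ℝ) (p d : ℝ) : Prop :=
  |d| ≤ 1 ∧ ∀ v, |v| ≤ 1 → runningCost U w v - p * v ≤ runningCost U w d - p * d → v = d

theorem IsStrictMinimizer.neg {U w : Fin N → ℝ} {p d : ℝ} (h : IsStrictMinimizer U w p d) :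
    IsStrictMinimizer U w (-p) (-d) := by
  refine ⟨by rw [abs_neg]; exact h.1, fun v hv hle => ?_⟩
  rw [runningCost_neg U w d] at hle
  have := h.2 (-v) (by rwa [abs_neg]) (by rw [runningCost_neg]; linarith)
  linarith

/-- Off the slopes, the minimizer is unique and locally constant: positive multipliers. -/
theorem exists_isStrictMinimizer_of_pos {U w : Fin N → ℝ} (hN : 0 < N) (hw : ∀ i, 0 < w i)
    (hU : StrictMono U) (hU0 : ∀ i, 0 ≤ U i) (hU1 : ∀ i, U i ≤ 1)
    (hlast : U ⟨N - 1, Nat.sub_lt hN Nat.one_pos⟩ = 1) {p : ℝ} (hp : 0 < p)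
    (hS : ∀ k : Fin N, p ≠ slope w k) :
    ∃ d, ∀ᶠ q in nhds p, IsStrictMinimizer U w q d := by
  have hne : (Finset.univ.filter fun k : Fin N => slope w k < p).Nonempty :=
    ⟨⟨0, hN⟩, by simp [slope_zero, hp]⟩
  -- The last index whose left slope is below p: then p lies strictly between the two slopes at U k.
  obtain ⟨k, hk, hmax⟩ := Finset.exists_max_image _ id hne
  simp only [Finset.mem_filter, Finset.mem_univ, true_and, id] at hk hmax
  have hleft : ∀ᶠ q in nhds p, slope w k < q := lt_mem_nhds hk
  have hright : ∀ᶠ q in nhds p, ∀ v, |v| ≤ 1 → U k < v → q < slope w (k + 1) := by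
    by_cases hkN : (k : ℕ) + 1 < N
    · have h1 : ¬ slope w ((⟨k + 1, hkN⟩ : Fin N) : ℕ) < p := fun h => by
        have := Fin.le_def.1 (hmax _ h)
        simp at this
      have h2 : p < slope w (k + 1) := lt_of_le_of_ne (not_lt.1 h1) (hS ⟨k + 1, hkN⟩)
      filter_upwards [gt_mem_nhds h2] with q hq v _ _ using hq
    -- At the last index U k = 1, so the constraint |v| ≤ 1 replaces the right slope.
    · refine Filter.Eventually.of_forall fun q v hv hkv => ?_
      have : k = ⟨N - 1, Nat.sub_lt hN Nat.one_pos⟩ := Fin.ext (by simp; omega)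
      rw [this, hlast] at hkv
      exact absurd (abs_le.1 hv).2 (not_le.2 hkv)
  refine ⟨U k, ?_⟩
  filter_upwards [hleft, hright] with q h1 h2
  refine ⟨abs_le.2 ⟨by linarith [hU0 k], hU1 k⟩, fun v hv hle => ?_⟩
  by_contra hvk
  rcases lt_or_gt_of_ne hvk with h | h
  · have h3 := runningCost_ge_left hw hU hU0 k v
    have := mul_pos (sub_pos.2 h1) (sub_pos.2 h)
    nlinarith
  · have h3 := runningCost_ge_right hw hU hU0 k h.le
    have := mul_pos (sub_pos.2 (h2 v hv h)) (sub_pos.2 h)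
    nlinarith

/-- Off the slopes, the minimizer is unique and locally constant. -/
theorem exists_isStrictMinimizer {U w : Fin N → ℝ} (hN : 0 < N) (hw : ∀ i, 0 < w i)
    (hU : StrictMono U) (hU0 : ∀ i, 0 ≤ U i) (hU1 : ∀ i, U i ≤ 1)
    (hlast : U ⟨N - 1, Nat.sub_lt hN Nat.one_pos⟩ = 1) {p : ℝ}
    (hp0 : p = 0 → U ⟨0, hN⟩ = 0)
    (hS : ∀ k : Fin N, (k : ℕ) ≠ 0 → p ^ 2 ≠ slope w k ^ 2) :
    ∃ d, ∀ᶠ q in nhds p, IsStrictMinimizer U w q d := by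
  have hS' : ∀ k : Fin N, (k : ℕ) ≠ 0 → p ≠ slope w k ∧ -p ≠ slope w k := by
    intro k hk
    exact ⟨fun h => hS k hk (by rw [h]), fun h => hS k hk (by rw [← h]; ring)⟩
  rcases lt_trichotomy p 0 with h | h | h
  · obtain ⟨d, hd⟩ := exists_isStrictMinimizer_of_pos hN hw hU hU0 hU1 hlast (neg_pos.2 h)
      (fun k => by
        by_cases hk : (k : ℕ) = 0
        · rw [hk, slope_zero]
          exact (neg_pos.2 h).ne'
        · exact (hS' k hk).2)
    refine ⟨-d, ?_⟩
    have ht : Filter.Tendsto (fun q : ℝ => -q) (nhds p) (nhds (-p)) := continuous_neg.tendsto p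
    filter_upwards [ht.eventually hd] with q hq
    simpa using hq.neg
  -- With U_1 = 0 the cost has a kink at 0, so 0 stays the strict minimizer for |q| < s_1.
  · have h0 := hp0 h
    subst h
    have hs1 : 0 < slope w 1 := slope_pos hw hN one_pos
    refine ⟨0, ?_⟩
    filter_upwards [gt_mem_nhds hs1, lt_mem_nhds (neg_lt_zero.2 hs1)] with q h1 h2
    have key : ∀ v, 0 ≤ v → runningCost U w 0 + slope w 1 * v ≤ runningCost U w v := by
      intro v hv
      have := runningCost_ge_right hw hU hU0 ⟨0, hN⟩ (v := v) (by rwa [h0])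
      simpa [h0] using this
    refine ⟨by simp, fun v _ hle => ?_⟩
    by_contra hv0
    rcases lt_or_gt_of_ne hv0 with h | h
    · have h3 := key (-v) (by linarith)
      rw [runningCost_neg] at h3
      nlinarith
    · have h3 := key v h.le
      nlinarith
  · exact exists_isStrictMinimizer_of_pos hN hw hU hU0 hU1 hlast h (fun k => by
      by_cases hk : (k : ℕ) = 0
      · rw [hk, slope_zero]
        exact h.ne'
      · exact (hS' k hk).1)

/-- The minimum of the running cost. -/
theorem le_runningCost {U w : Fin N → ℝ} (hw : ∀ i, 0 < w i) (v : ℝ) :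
    2 * ∑ i, w i * U i ≤ runningCost U w v := by
  unfold runningCost
  rw [Finset.mul_sum]
  refine Finset.sum_le_sum fun i _ => ?_
  have := mul_le_mul_of_nonneg_left
    (add_le_add (neg_le_abs (v - U i)) (le_abs_self (v + U i))) (hw i).le
  linarith

theorem runningCost_first {U w : Fin N → ℝ} (hN : 0 < N) (hU : StrictMono U)
    (hU0 : ∀ i, 0 ≤ U i) : runningCost U w (U ⟨0, hN⟩) = 2 * ∑ i, w i * U i := by
  unfold runningCost
  rw [Finset.mul_sum]
  refine Finset.sum_congr rfl fun i _ => ?_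
  have h1 : U ⟨0, hN⟩ ≤ U i := hU.monotone (Fin.le_def.2 (Nat.zero_le _))
  have h2 := hU0 i
  have h3 := hU0 ⟨0, hN⟩
  rw [abs_of_nonpos (by linarith), abs_of_nonneg (by linarith)]
  ring

/-! ### Location of the switchings and the global count -/

/-- A control that is almost everywhere equal to `d` near `t` does not switch at `t`. -/
theorem notMem_switchingInstants {T : ℝ} {u : ℝ → ℝ} (hu : IsControl T u) {H : ℝ → ℝ → ℝ} {d t : ℝ}
    (ht : t ∈ Set.Ioo 0 T)
    (hH : ∀ᵐ s ∂(volume.restrict (Set.Icc 0 T)), H s (u s) ≤ H s d)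
    (hd : ∀ᶠ s in nhds t, ∀ v, |v| ≤ 1 → H s v ≤ H s d → v = d) :
    t ∉ switchingInstants T u := by
  rintro ⟨-, hne⟩
  refine hne ?_
  obtain ⟨ε, hε, hball⟩ := Metric.eventually_nhds_iff_ball.1
    (hd.and (Icc_mem_nhds ht.1 ht.2))
  rw [Real.ball_eq_Ioo] at hball
  refine ⟨ε, hε, d, ?_⟩
  have hsub : Set.Ioo (t - ε) (t + ε) ⊆ Set.Icc 0 T := fun s hs => (hball s hs).2
  have hle := Measure.restrict_mono hsub (le_refl volume)
  filter_upwards [ae_mono hle hH, ae_mono hle hu.2, ae_restrict_mem measurableSet_Ioo]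
    with s h1 h2 h3
  exact (hball s h3).1 _ h2 h1

/-- The positive levels that a multiplier crosses where an optimal control switches. -/
noncomputable def levels (w : Fin N → ℝ) : Finset ℝ :=
  (Finset.univ.filter fun k : Fin N => (k : ℕ) ≠ 0).image fun k : Fin N => slope w k

theorem card_levels (w : Fin N → ℝ) (hN : 0 < N) : (levels w).card ≤ N - 1 := by
  refine Finset.card_image_le.trans ?_
  rw [Finset.filter_congr (q := fun k : Fin N => k ≠ ⟨0, hN⟩) (by simp [Fin.ext_iff]),
    Finset.filter_ne', Finset.card_erase_of_mem (Finset.mem_univ _), Finset.card_univ,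
    Fintype.card_fin]

/-- Where an optimal control can switch: either at the zeros of a nonzero response, or where a
response vanishes or crosses one of the levels. -/
theorem IsOptimal.switchingInstants_subset {A : Matrix (Fin n) (Fin n) ℝ} {B : Fin n → ℝ} {T : ℝ}
    (hT : 0 < T) (hN : 0 < N) {U w : Fin N → ℝ} (hw : ∀ i, 0 < w i) (hU : StrictMono U)
    (hU0 : ∀ i, 0 ≤ U i) (hU1 : ∀ i, U i ≤ 1)
    (hlast : U ⟨N - 1, Nat.sub_lt hN Nat.one_pos⟩ = 1) {ξ : Fin n → ℝ} {u : ℝ → ℝ}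
    (hopt : IsOptimal A B U w T ξ u) :
    (∃ l, l ≠ 0 ∧ ∀ t ∈ switchingInstants T u, response (-A) B l t = 0) ∨
    ∃ l, (l = 0 → cost U w T u = costMin U w T) ∧ ∀ t ∈ switchingInstants T u,
      (response (-A) B l t = 0 ∧ U ⟨0, hN⟩ ≠ 0) ∨
        ∃ c ∈ levels w, response (-A) B l t ^ 2 = c ^ 2 := by
  have hu : IsControl T u := hopt.1.1
  obtain ⟨c, l, hc, hcl, hmin⟩ := hopt.exists_multiplier hT.le hw
  have hae := fun d hd => ae_le_of_integral_le hT.le hu (-A) B l c hmin (d := d) hd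
  rcases hc.eq_or_lt with hc0 | hc0
  -- Abnormal case: the cost drops out and u is minus the sign of the response wherever that is
  -- nonzero.
  · left
    subst hc0
    refine ⟨l, by simpa using hcl, fun t ht => ?_⟩
    by_contra hne
    rcases lt_or_gt_of_ne hne with h | h
    · refine notMem_switchingInstants hu ht.1
        (H := fun s v => 0 * runningCost U w v + v * response (-A) B l s)
        (d := 1) (hae 1 (by simp)) ?_ ht
      filter_upwards [(continuous_response (-A) B l).continuousAt.eventually_lt_const h]
        with s hs v hv hle
      have := (abs_le.1 hv).2
      nlinarith
    · refine notMem_switchingInstants hu ht.1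
        (H := fun s v => 0 * runningCost U w v + v * response (-A) B l s)
        (d := -1) (hae (-1) (by simp)) ?_ ht
      filter_upwards [(continuous_response (-A) B l).continuousAt.eventually_const_lt h]
        with s hs v hv hle
      have := (abs_le.1 hv).1
      nlinarith
  · right
    -- Dividing by c normalizes the minimized expression to L(v) - pv, with p the response of -c⁻¹λ.
    have hval : ∀ t, c * response (-A) B (-(c⁻¹ • l)) t = -response (-A) B l t := by
      intro t
      rw [map_neg, map_smul]
      simp [hc0.ne']
    refine ⟨-(c⁻¹ • l), fun h0 => ?_, fun t ht => ?_⟩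
    · rw [h0] at hval
      have hq : ∀ t, response (-A) B l t = 0 := fun t => by simpa using (hval t).symm
      have h1 := hae (U ⟨0, hN⟩) (abs_le.2 ⟨by linarith [hU0 ⟨0, hN⟩], hU1 _⟩)
      have h2 : ∀ᵐ t ∂(volume.restrict (Set.Icc 0 T)),
          runningCost U w (u t) = 2 * ∑ i, w i * U i := by
        filter_upwards [h1] with t ht
        rw [hq, mul_zero, mul_zero, add_zero, add_zero, runningCost_first hN hU hU0] at ht
        exact le_antisymm (le_of_mul_le_mul_left ht hc0) (le_runningCost hw _)
      rw [hu.cost_eq hT.le, integral_congr_ae h2, costMin]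
      simp [hT.le]
      ring
    · by_contra! hcon
      obtain ⟨d, hd⟩ := exists_isStrictMinimizer hN hw hU hU0 hU1 hlast
        (p := response (-A) B (-(c⁻¹ • l)) t) (fun h => hcon.1 h)
        (fun k hk => hcon.2 _ (Finset.mem_image.2 ⟨k, by simp [hk], rfl⟩))
      refine notMem_switchingInstants hu ht.1
        (H := fun s v => c * runningCost U w v + v * response (-A) B l s)
        (d := d) (hae d hd.self_of_nhds.1) ?_ ht
      filter_upwards [(continuous_response (-A) B (-(c⁻¹ • l))).continuousAt.eventually hd]
        with s hs v hv hle
      refine hs.2 v hv (le_of_mul_le_mul_left ?_ hc0)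
      have := hval s
      rw [mul_sub, mul_sub, ← mul_assoc, ← mul_assoc, this]
      linarith

/-- From a bound on intervals of length less than `π / Ω` to a bound on `(0, T)`. -/
theorem finite_and_ncard_le_mul {T Ω : ℝ} (hT : 0 < T) (hΩ : 0 ≤ Ω) {Z : Set ℝ}
    (hZ : Z ⊆ Set.Ioo 0 T) {m : ℕ}
    (h : ∀ a b : ℝ, a ≤ b → Ω * (b - a) < Real.pi → ∀ s : Finset ℝ, (∀ x ∈ s, x ∈ Z) →
      (∀ x ∈ s, x ∈ Set.Icc a b) → s.card ≤ m) {C : ℝ} (hm : (m : ℝ) < C) :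
    Z.Finite ∧ (Z.ncard : ℝ) < C * (1 + Ω * T / Real.pi) := by
  have hr : 0 ≤ Ω * T / Real.pi := by positivity
  -- The least integer above ΩT/π: pieces of length T/k satisfy Ω T/k < π, and still k ≤ 1 + ΩT/π.
  set k := ⌊Ω * T / Real.pi⌋₊ + 1 with hk
  have hk1 : (k : ℝ) ≤ 1 + Ω * T / Real.pi := by
    rw [hk, Nat.cast_add, Nat.cast_one, add_comm]
    linarith [Nat.floor_le hr]
  have hk2 : Ω * T < k * Real.pi := by
    rw [← div_lt_iff₀ Real.pi_pos, hk, Nat.cast_add, Nat.cast_one]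
    exact Nat.lt_floor_add_one _
  have hk0 : (0 : ℝ) < k := by rw [hk]; positivity
  obtain ⟨hfin, hcard⟩ := finite_and_ncard_le hT hZ (k := k) (m := m) (by omega)
    (fun a b hab hlt s hs hs' => h a b hab (by
      refine (mul_le_mul_of_nonneg_left hlt hΩ).trans_lt ?_
      rw [mul_div_assoc', div_lt_iff₀ hk0, mul_comm Real.pi]
      exact hk2) s hs hs')
  refine ⟨hfin, ?_⟩
  calc (Z.ncard : ℝ) ≤ m * k := by exact_mod_cast hcard
    _ ≤ m * (1 + Ω * T / Real.pi) := by gcongr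
    _ < C * (1 + Ω * T / Real.pi) := by gcongr

end SOAV

/-! ### The theorem -/

theorem mainTheorem5 {n N : ℕ} (hn : 0 < n) (hN : 0 < N)
    (A : Matrix (Fin n) (Fin n) ℝ) (B : Fin n → ℝ) (T : ℝ) (hT : 0 < T)
    (U w : Fin N → ℝ) (hU_mono : StrictMono U) (hU_nonneg : 0 ≤ U ⟨0, hN⟩)
    (hU_last : U ⟨N - 1, Nat.sub_lt hN Nat.one_pos⟩ = 1)
    (hw_pos : ∀ i, 0 < w i) (hw_sum : ∑ i, w i = 1)
    (hA : IsUnit A.det) (hAB : SOAV.IsControllable A B)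
    (Ω : ℝ) (hΩ : IsGreatest (SOAV.eigenvalueImParts A) Ω) :
    (∀ ξ ∈ SOAV.reachable A B T \ SOAV.reachableMin A B U w T,
      ∀ u : ℝ → ℝ, SOAV.IsOptimal A B U w T ξ u →
        (SOAV.switchingInstants T u).Finite ∧
          ((SOAV.switchingInstants T u).ncard : ℝ) <
            n * (2 * N - 1) * (1 + Ω * T / Real.pi)) ∧
    (U ⟨0, hN⟩ = 0 →
      ∀ ξ ∈ SOAV.reachable A B T,
        ∀ u : ℝ → ℝ, SOAV.IsOptimal A B U w T ξ u →
          (SOAV.switchingInstants T u).Finite ∧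
            ((SOAV.switchingInstants T u).ncard : ℝ) <
              2 * n * (N - 1) * (1 + Ω * T / Real.pi)) := by
  have hU0 : ∀ i, 0 ≤ U i := fun i =>
    hU_nonneg.trans (hU_mono.monotone (Fin.le_def.2 (Nat.zero_le _)))
  have hU1 : ∀ i, U i ≤ 1 := fun i => by
    rw [← hU_last]
    exact hU_mono.monotone (Fin.le_def.2 (by simp; omega))
  have hΩ0 := SOAV.imPart_nonneg hΩ hn
  have hsub : ∀ u : ℝ → ℝ, SOAV.switchingInstants T u ⊆ Set.Ioo 0 T := fun u t ht => ht.1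
  -- From here on `n` and `N` stand for one less than in the statement.
  obtain ⟨n, rfl⟩ : ∃ m, n = m + 1 := ⟨n - 1, by omega⟩
  obtain ⟨N, rfl⟩ : ∃ m, N = m + 1 := ⟨N - 1, by omega⟩
  have hlev := SOAV.card_levels w hN
  simp only [Nat.add_sub_cancel] at hlev
  have hsingular : ∀ (u : ℝ → ℝ) (l : Fin (n + 1) → ℝ), l ≠ 0 →
      (∀ t ∈ SOAV.switchingInstants T u, SOAV.response (-A) B l t = 0) → ∀ C : ℝ, (n : ℝ) < C →
      (SOAV.switchingInstants T u).Finite ∧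
        ((SOAV.switchingInstants T u).ncard : ℝ) < C * (1 + Ω * T / Real.pi) := by
    intro u l hl hz C hC
    exact SOAV.finite_and_ncard_le_mul hT hΩ0 (hsub u) (fun a b hab hlt s hs hs' =>
      Nat.lt_succ_iff.1 (SOAV.card_zeros_response_lt hAB hΩ hl hab hlt s hs'
        fun x hx => hz x (hs x hx))) hC
  have hcross : ∀ (l : Fin (n + 1) → ℝ), l ≠ 0 → ∀ a b : ℝ, a ≤ b → Ω * (b - a) < Real.pi →
      ∀ s : Finset ℝ, (∀ x ∈ s, x ∈ Set.Icc a b) →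
      (∀ x ∈ s, ∃ c ∈ SOAV.levels w, SOAV.response (-A) B l x ^ 2 = c ^ 2) →
      s.card ≤ N * (2 * n + 1) := fun l hl a b hab hlt s hs hz =>
    (SOAV.card_levels_le hA hAB hΩ hl hab hlt _ s hs hz).trans (Nat.mul_le_mul hlev (by omega))
  constructor
  · rintro ξ ⟨-, hξ⟩ u hopt
    have hpos : (0 : ℝ) ≤ n := Nat.cast_nonneg n
    have hposN : (0 : ℝ) ≤ N := Nat.cast_nonneg N
    rcases hopt.switchingInstants_subset hT hN hw_pos hU_mono hU0 hU1 hU_last with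
      ⟨l, hl, hz⟩ | ⟨l, hl, hz⟩
    · refine hsingular u l hl hz _ ?_
      push_cast
      nlinarith [mul_nonneg hpos hposN]
    -- With λ = 0 the optimal u would attain J_min, putting ξ in ℛ_min.
    · have hl0 : l ≠ 0 := fun h0 => hξ ⟨⟨u, hopt.1, hl h0⟩, by
        rintro _ ⟨v, hv, rfl⟩
        rw [← hl h0]
        exact hopt.2 v hv⟩
      -- Zeros of the response, plus 2n + 1 points for each of at most N levels.
      refine SOAV.finite_and_ncard_le_mul hT hΩ0 (hsub u) (m := n + N * (2 * n + 1))
        (fun a b hab hlt s hs hs' => ?_) ?_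
      · classical
        have h1 := Nat.lt_succ_iff.1 (SOAV.card_zeros_response_lt hAB hΩ hl0 hab hlt
          (s.filter fun x => SOAV.response (-A) B l x = 0)
          (fun x hx => hs' x (Finset.mem_filter.1 hx).1) (fun x hx => (Finset.mem_filter.1 hx).2))
        have h2 := hcross l hl0 a b hab hlt
          (s.filter fun x => ¬ SOAV.response (-A) B l x = 0)
          (fun x hx => hs' x (Finset.mem_filter.1 hx).1) (fun x hx => by
            obtain ⟨hx1, hx2⟩ := Finset.mem_filter.1 hx
            exact (hz x (hs x hx1)).resolve_left fun h => hx2 h.1)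
        have h3 := Finset.card_filter_add_card_filter_not (s := s)
          (fun x => SOAV.response (-A) B l x = 0)
        omega
      · push_cast
        nlinarith [mul_nonneg hpos hposN]
  · intro hU00 ξ _ u hopt
    -- U_1 = 0 and U_N = 1 force at least two levels, so the bound is large enough for the abnormal
    -- case too.
    have hN1 : 1 ≤ N := by
      by_contra h
      obtain rfl : N = 0 := by omega
      have : U ⟨0, hN⟩ = 1 := hU_last
      linarith
    have hpos : (0 : ℝ) ≤ n := Nat.cast_nonneg n
    have hposN : (1 : ℝ) ≤ N := by exact_mod_cast hN1
    rcases hopt.switchingInstants_subset hT hN hw_pos hU_mono hU0 hU1 hU_last with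
      ⟨l, hl, hz⟩ | ⟨l, hl, hz⟩
    · refine hsingular u l hl hz _ ?_
      push_cast
      nlinarith [mul_nonneg hpos (sub_nonneg.2 hposN)]
    · have hz' : ∀ t ∈ SOAV.switchingInstants T u,
          ∃ c ∈ SOAV.levels w, SOAV.response (-A) B l t ^ 2 = c ^ 2 :=
        fun t ht => (hz t ht).resolve_left fun h => h.2 hU00
      refine SOAV.finite_and_ncard_le_mul hT hΩ0 (hsub u) (m := N * (2 * n + 1))
        (fun a b hab hlt s hs hs' => ?_) ?_
      -- Here λ = 0 is allowed, but the zero response meets no positive level, so nothing switches.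
      · by_cases hl0 : l = 0
        · have : s = ∅ := by
            rw [Finset.eq_empty_iff_forall_notMem]
            intro x hx
            obtain ⟨c, hc, h⟩ := hz' x (hs x hx)
            obtain ⟨k, hk, rfl⟩ := Finset.mem_image.1 hc
            have := SOAV.slope_pos hw_pos hN (Nat.pos_of_ne_zero (Finset.mem_filter.1 hk).2)
            rw [hl0] at h
            simp only [map_zero, Pi.zero_apply, ne_eq, OfNat.ofNat_ne_zero, not_false_eq_true,
              zero_pow] at h
            exact (pow_pos this 2).ne h
          simp [this]
        · exact hcross l hl0 a b hab hlt s hs' fun x hx => hz' x (hs x hx)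
      · push_cast
        nlinarith
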